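/- Let $\mu$ be a finite Borel measure on $[0,\infty)$ whose support is nonempty, bounded and bounded away from zero, let $m_\mu=\inf\operatorname{supp}\mu>0$, and put $h(z)=\int_0^\infty e^{-tz}\,\mu(dt)$. For $q\in\{1,2\}$ and $p\in\mathbb N$ let $\mathcal H$ be the reproducing kernel Hilbert space on $\mathbb R^p$ with kernel $k(x,x')=h(\|x-x'\|_q^q)$. For a probability distribution $Q$ of $(X,Y)\in\mathbb R^p\times\mathbb R$, $\lambda>0$ and $\beta\in\mathbb R^p$ with $\beta\ge 0$ (coordinatewise) put $$F_\lambda^{\rm KRR}(\beta;Q)=\min_{f\in\mathcal H}\ \tfrac12\,\mathbb E_Q\big[(Y-f(\beta^{1/q}\odot X))^2\big]+\tfrac{\lambda}{2}\|f\|_{\mathcal H}^2,$$ where $\beta^{1/q}\odot X=(\beta_i^{1/q}X_i)_{i}$. Assume that $\mathbb E_Q[Y]=0$, that $\|X\|_\infty\le M_X<\infty$ and $|Y|\le M_Y<\infty$ almost surely, with $M_Y>0$, and that $\operatorname{Var}_Q(X_l)>0$ for all $l\in\{1,\dots,p\}$. Let the signal set $S$ be the minimal subset of $\{1,\dots,p\}$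 such that $\mathbb E_Q[Y\mid X]=\mathbb E_Q[Y\mid X_S]$ and $X_S$ is independent of $X_{S^c}$ under $Q$. Theorem. There is a constant $C>0$ depending only on $\mu$, $M_X$ and $M_Y$ such that for all $\lambda>0$, all $\beta\ge 0$ and every $j\notin S$, the partial derivative $\partial_{\beta_j}F_\lambda^{\rm KRR}(\beta;Q)$ (one-sided, from the right, if $\beta_j=0$) exists and $$\partial_{\beta_j}F_\lambda^{\rm KRR}(\beta;Q)\ \ge\ c_j\,\lambda\,\big(F_\lambda^{\rm KRR}(0;Q)-F_\lambda^{\rm KRR}(\beta;Q)\big)_+^2-C\,\frac{1+\lambda^2}{\lambda^2}\,\|\beta_{S^c}\|_1,$$ where $$c_j=\frac{m_\mu\,\mathbb E_Q\big[|X_j-X_j'|^q\big]}{|h(0)|\,M_Y^2}>0$$ and $X'$ is an independent copy of $X$. -/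

import Mathlib

open MeasureTheory ProbabilityTheory
open scoped NNReal

namespace KRR

/-- The profile `h(z) = ∫ e^{-tz} μ(dt)` of the kernel; `μ` is a measure on `[0, ∞)`. -/
noncomputable def profile (μ : Measure ℝ≥0) (z : ℝ) : ℝ :=
  ∫ t, Real.exp (-((t : ℝ) * z)) ∂μ

/-- The kernel `k(x, x') = h(‖x - x'‖_q^q)` on `ℝ^p`.  In Mathlib a kernel takes values in the
continuous linear maps `ℝ → ℝ`, and the real number `a` is represented by the map `v ↦ a v`. -/
noncomputable def kernelMatrix (μ : Measure ℝ≥0) (q p : ℕ) :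
    Matrix (Fin p → ℝ) (Fin p → ℝ) (ℝ →L[ℝ] ℝ) :=
  Matrix.of fun x y => profile μ (∑ i, |x i - y i| ^ q) • ContinuousLinearMap.id ℝ ℝ

/-! ### The kernel is positive semidefinite (needed in order to build its Hilbert space) -/

/-- A mixture of positive semidefinite matrices is positive semidefinite. -/
theorem posSemidef_integral {ι Ω : Type*} [Fintype ι] [MeasurableSpace Ω] (ν : Measure Ω)
    (K : Ω → Matrix ι ι ℝ) (hint : ∀ i j, Integrable (fun s => K s i j) ν)
    (hK : ∀ s, (K s).PosSemidef) :
    (Matrix.of fun i j => ∫ s, K s i j ∂ν).PosSemidef := by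
  refine Matrix.PosSemidef.of_dotProduct_mulVec_nonneg ?_ fun x => ?_
  · ext i j
    simp only [Matrix.conjTranspose_apply, Matrix.of_apply, star_trivial]
    congr 1
    funext s
    simpa using (hK s).isHermitian.apply i j
  · have h : ∀ s, 0 ≤ ∑ i, ∑ j, x i * (K s i j * x j) := fun s => by
      simpa [dotProduct, Matrix.mulVec, Finset.mul_sum] using (hK s).dotProduct_mulVec_nonneg x
    have e : star x ⬝ᵥ (Matrix.of fun i j => ∫ s, K s i j ∂ν).mulVec x
        = ∫ s, ∑ i, ∑ j, x i * (K s i j * x j) ∂ν := by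
      rw [integral_finsetSum _ fun i _ => integrable_finsetSum _ fun j _ =>
        ((hint i j).mul_const _).const_mul _]
      simp only [dotProduct, Matrix.mulVec, Finset.mul_sum, star_trivial, Pi.star_apply,
        Matrix.of_apply]
      refine Finset.sum_congr rfl fun i _ => ?_
      rw [integral_finsetSum _ fun j _ => ((hint i j).mul_const _).const_mul _]
      refine Finset.sum_congr rfl fun j _ => ?_
      rw [integral_const_mul, integral_mul_const]
    rw [e]
    exact integral_nonneg h

/-- A Gram matrix of square integrable functions is positive semidefinite. -/
theorem posSemidef_gram {ι Ω : Type*} [Fintype ι] [MeasurableSpace Ω] (ν : Measure Ω)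
    (φ : ι → Ω → ℝ) (hint : ∀ i j, Integrable (fun s => φ i s * φ j s) ν) :
    (Matrix.of fun i j => ∫ s, φ i s * φ j s ∂ν).PosSemidef := by
  refine posSemidef_integral ν (fun s => Matrix.vecMulVec (fun i => φ i s) (fun i => φ i s))
    hint fun s => ?_
  simpa using Matrix.posSemidef_vecMulVec_self_star (fun i => φ i s)

theorem posSemidef_laplace {ι : Type*} [Fintype ι] (t : ℝ) (ht : 0 < t) (x : ι → ℝ) :
    (Matrix.of fun i j => Real.exp (-(t * |x i - x j|))).PosSemidef := by
  have key : ∀ i j s, Set.indicator (Set.Iic (x i)) (fun s => Real.exp (-(t * (x i - s)))) s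
      * Set.indicator (Set.Iic (x j)) (fun s => Real.exp (-(t * (x j - s)))) s
      = Set.indicator (Set.Iic (min (x i) (x j)))
        (fun s => Real.exp (-(t * (x i + x j))) * Real.exp (2 * t * s)) s := by
    intro i j s
    by_cases h1 : s ≤ x i <;> by_cases h2 : s ≤ x j <;>
      simp [Set.indicator, h1, h2]
    rw [← Real.exp_add, ← Real.exp_add]
    ring_nf
  have hg := (posSemidef_gram (volume : Measure ℝ)
    (fun i => Set.indicator (Set.Iic (x i)) (fun s => Real.exp (-(t * (x i - s)))))
    (fun i j => by
      simp_rw [key i j]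
      exact (integrable_indicator_iff measurableSet_Iic).2
        ((integrableOn_exp_mul_Iic (by positivity : 0 < 2 * t) _).const_mul _))).smul (by positivity : (0 : ℝ) ≤ 2 * t)
  convert hg using 1
  ext i j
  simp only [Matrix.of_apply, Matrix.smul_apply, smul_eq_mul, key i j]
  rw [integral_indicator measurableSet_Iic, integral_const_mul,
    integral_exp_mul_Iic (by positivity : 0 < 2 * t)]
  have : 2 * t * (Real.exp (-(t * (x i + x j))) * (Real.exp (2 * t * min (x i) (x j)) / (2 * t)))
      = Real.exp (-(t * (x i + x j))) * Real.exp (2 * t * min (x i) (x j)) := by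
    field_simp
  rw [this, ← Real.exp_add]
  congr 1
  rcases le_total (x i) (x j) with h | h
  · rw [min_eq_left h, abs_of_nonpos (by linarith)]; ring
  · rw [min_eq_right h, abs_of_nonneg (by linarith)]; ring

theorem posSemidef_gauss {ι : Type*} [Fintype ι] (t : ℝ) (ht : 0 < t) (x : ι → ℝ) :
    (Matrix.of fun i j => Real.exp (-(t * |x i - x j| ^ 2))).PosSemidef := by
  have key : ∀ i j s, Real.exp (-(2 * t * (x i - s) ^ 2)) * Real.exp (-(2 * t * (x j - s) ^ 2))
      = Real.exp (-(t * |x i - x j| ^ 2))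
        * Real.exp (-(4 * t) * (s - (x i + x j) / 2) ^ 2) := by
    intro i j s
    rw [← Real.exp_add, ← Real.exp_add, sq_abs]
    ring_nf
  have hpos : 0 < √(Real.pi / (4 * t)) := by positivity
  have hg := (posSemidef_gram (volume : Measure ℝ)
    (fun i s => Real.exp (-(2 * t * (x i - s) ^ 2)))
    (fun i j => by
      simp_rw [key i j]
      exact ((integrable_exp_neg_mul_sq (by positivity : 0 < 4 * t)).comp_sub_right _).const_mul
        _)).smul (inv_nonneg.2 hpos.le)
  convert hg using 1
  ext i j
  simp only [Matrix.of_apply, Matrix.smul_apply, smul_eq_mul, key i j]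
  rw [integral_const_mul,
    integral_sub_right_eq_self (fun s => Real.exp (-(4 * t) * s ^ 2)) ((x i + x j) / 2),
    integral_gaussian]
  field_simp

theorem posSemidef_ones {ι : Type*} [Fintype ι] :
    (Matrix.of fun _ _ : ι => (1 : ℝ)).PosSemidef := by
  simpa [Matrix.vecMulVec] using Matrix.posSemidef_vecMulVec_self_star (fun _ : ι => (1 : ℝ))

theorem posSemidef_exp {ι : Type*} [Fintype ι] (q p : ℕ) [hq : Fact (q = 1 ∨ q = 2)]
    (t : ℝ) (ht : 0 ≤ t) (x : ι → Fin p → ℝ) :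
    (Matrix.of fun i j => Real.exp (-(t * ∑ l, |x i l - x j l| ^ q))).PosSemidef := by
  have h1 : ∀ l, (Matrix.of fun i j => Real.exp (-(t * |x i l - x j l| ^ q))).PosSemidef := by
    intro l
    rcases ht.eq_or_lt with rfl | ht
    · simpa using posSemidef_ones
    · rcases hq.out with rfl | rfl
      · simpa using posSemidef_laplace t ht fun i => x i l
      · exact posSemidef_gauss t ht fun i => x i l
  have h2 : ∀ s : Finset (Fin p),
      (Matrix.of fun i j => Real.exp (-(t * ∑ l ∈ s, |x i l - x j l| ^ q))).PosSemidef := by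
    intro s
    induction s using Finset.induction_on with
    | empty => simpa using posSemidef_ones
    | insert a s ha ih =>
      have e : (Matrix.of fun i j => Real.exp (-(t * ∑ l ∈ insert a s, |x i l - x j l| ^ q)))
          = Matrix.hadamard (Matrix.of fun i j => Real.exp (-(t * |x i a - x j a| ^ q)))
            (Matrix.of fun i j => Real.exp (-(t * ∑ l ∈ s, |x i l - x j l| ^ q))) := by
        ext i j
        simp only [Matrix.of_apply, Matrix.hadamard_apply]
        rw [Finset.sum_insert ha, ← Real.exp_add]
        ring_nf
      rw [e]
      exact (h1 a).hadamard ih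
  exact h2 _

theorem posSemidef_profile {ι : Type*} [Fintype ι] (μ : Measure ℝ≥0) [IsFiniteMeasure μ]
    (q p : ℕ) [Fact (q = 1 ∨ q = 2)] (x : ι → Fin p → ℝ) :
    (Matrix.of fun i j => profile μ (∑ l, |x i l - x j l| ^ q)).PosSemidef := by
  refine posSemidef_integral μ
    (fun t => Matrix.of fun i j => Real.exp (-((t : ℝ) * ∑ l, |x i l - x j l| ^ q)))
    (fun i j => ?_) fun t => posSemidef_exp q p t t.2 x
  refine Integrable.of_bound (C := 1) (by simp only [Matrix.of_apply]; fun_prop)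
    (Filter.Eventually.of_forall fun t => ?_)
  simp only [Matrix.of_apply, Real.norm_eq_abs, Real.abs_exp, Real.exp_le_one_iff,
    Left.neg_nonpos_iff]
  exact mul_nonneg t.2 (Finset.sum_nonneg fun l _ => by positivity)

theorem posSemidef_kernelMatrix (μ : Measure ℝ≥0) [IsFiniteMeasure μ] (q p : ℕ)
    [Fact (q = 1 ∨ q = 2)] : (kernelMatrix μ q p).PosSemidef := by
  have hsymm : ∀ x y : Fin p → ℝ, ∑ i, |x i - y i| ^ q = ∑ i, |y i - x i| ^ q := fun x y =>
    Finset.sum_congr rfl fun i _ => by rw [abs_sub_comm]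
  refine ((RKHS.posSemidef_tfae (𝕜 := ℝ) (K := kernelMatrix μ q p)).out 0 2).2
    (And.intro ?_ fun v => ?_)
  · ext x y
    have h1 : star (ContinuousLinearMap.id ℝ ℝ) = ContinuousLinearMap.id ℝ ℝ :=
      star_one (ℝ →L[ℝ] ℝ)
    simp [kernelMatrix, hsymm y x, star_smul, h1]
  · have h := (posSemidef_profile μ q p (fun i : v.support => (i : Fin p → ℝ))).dotProduct_mulVec_nonneg
      (fun i => v i)
    simp only [dotProduct, Matrix.mulVec, Finset.mul_sum, Pi.star_apply, star_trivial,
      Matrix.of_apply] at h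
    rw [Finset.sum_coe_sort v.support (fun x => ∑ j : v.support,
      v x * (profile μ (∑ l, |x l - (j : Fin p → ℝ) l| ^ q) * v j))] at h
    simp only [Finsupp.sum, RCLike.re_to_real]
    refine h.trans_eq (Finset.sum_congr rfl fun x _ => ?_)
    rw [Finset.sum_coe_sort v.support (fun y =>
      v x * (profile μ (∑ l, |x l - y l| ^ q) * v y))]
    refine Finset.sum_congr rfl fun y _ => ?_
    simp [kernelMatrix, hsymm x y]
    ring

instance instFactPosSemidef (μ : Measure ℝ≥0) [IsFiniteMeasure μ] (q p : ℕ)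
    [Fact (q = 1 ∨ q = 2)] : Fact (kernelMatrix μ q p).PosSemidef :=
  ⟨posSemidef_kernelMatrix μ q p⟩

/-! ### The objective -/

/-- The reproducing kernel Hilbert space `H` of functions on `ℝ^p` with kernel
`k(x, x') = h(‖x - x'‖_q^q)`. -/
abbrev Space (μ : Measure ℝ≥0) [IsFiniteMeasure μ] (q p : ℕ) [Fact (q = 1 ∨ q = 2)] : Type :=
  RKHS.OfKernel (kernelMatrix μ q p)

/-- The vector `β^{1/q} ⊙ x`. -/
noncomputable def scale {p : ℕ} (q : ℕ) (β x : Fin p → ℝ) : Fin p → ℝ :=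
  fun i => β i ^ (1 / (q : ℝ)) * x i

/-- `F_λ(β; Q) = min_{f ∈ H} (1/2) E_Q[(Y - f(β^{1/q} ⊙ X))²] + (λ/2) ‖f‖_H²`,
where `Q` is the law of `(X, Y)`. -/
noncomputable def objective (μ : Measure ℝ≥0) [IsFiniteMeasure μ] (q : ℕ)
    [Fact (q = 1 ∨ q = 2)] {p : ℕ} (lam : ℝ) (Q : Measure ((Fin p → ℝ) × ℝ))
    (β : Fin p → ℝ) : ℝ :=
  ⨅ f : Space μ q p,
    (1 / 2 * ∫ z, (z.2 - f (scale q β z.1)) ^ 2 ∂Q + lam / 2 * ‖f‖ ^ 2)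

/-! ### Assumptions and the signal set -/

/-- `m_μ = inf supp μ`. -/
noncomputable def lowerEnd (μ : Measure ℝ≥0) : ℝ≥0 := sInf μ.support

/-- The support of `μ` is nonempty, bounded, and bounded away from zero.  (The infimum of the
empty set in `ℝ≥0` is `0`, so the first clause excludes `μ = 0`.) -/
structure KernelAssumption (μ : Measure ℝ≥0) : Prop where
  lowerEnd_pos : 0 < lowerEnd μ
  bddAbove : BddAbove μ.support

/-- `Y` is centered, `(X, Y)` is bounded (`‖X‖_∞ ≤ MX` and `|Y| ≤ MY`), and no coordinate of `X`
has zero variance. -/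
structure DataAssumption {p : ℕ} (Q : Measure ((Fin p → ℝ) × ℝ)) (MX MY : ℝ) : Prop where
  centered : ∫ z, z.2 ∂Q = 0
  bounded : ∀ᵐ z ∂Q, ‖z.1‖ ≤ MX ∧ |z.2| ≤ MY
  variance_pos : ∀ l, 0 < Var[fun z : (Fin p → ℝ) × ℝ => z.1 l; Q]

/-- `E_Q[Y | X] = E_Q[Y | X_S]`, and `X_S` is independent of `X_{Sᶜ}` under `Q`. -/
structure Captures {p : ℕ} (Q : Measure ((Fin p → ℝ) × ℝ)) (S : Finset (Fin p)) : Prop where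
  condExp_eq :
    Q[fun z => z.2 | MeasurableSpace.comap (fun z : (Fin p → ℝ) × ℝ => z.1) inferInstance]
      =ᵐ[Q]
    Q[fun z => z.2 |
      MeasurableSpace.comap (fun z : (Fin p → ℝ) × ℝ => S.restrict z.1) inferInstance]
  indep : IndepFun (fun z : (Fin p → ℝ) × ℝ => S.restrict z.1)
    (fun z : (Fin p → ℝ) × ℝ => Sᶜ.restrict z.1) Q

/-- `S` is the signal set of `Q`: a minimal set with the two properties above. -/
def IsSignalSet {p : ℕ} (Q : Measure ((Fin p → ℝ) × ℝ)) (S : Finset (Fin p)) : Prop :=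
  Minimal (Captures Q) S

/-- `c_j = m_μ E_Q[|X_j - X'_j|^q] / (|h(0)| MY²)`, with `(X', Y')` an independent copy of
`(X, Y)`. -/
noncomputable def gradConst (μ : Measure ℝ≥0) (q : ℕ) {p : ℕ} (Q : Measure ((Fin p → ℝ) × ℝ))
    (MY : ℝ) (j : Fin p) : ℝ :=
  lowerEnd μ * (∫ w, |w.1.1 j - w.2.1 j| ^ q ∂(Q.prod Q)) / (|profile μ 0| * MY ^ 2)

end KRR

/-! Let f be the minimizer, r = Y - f(β^{1/q} ⊙ X) its residual, and G the kernel h(∑ β_i |x_i -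
x'_i|^q) on the data space. The normal equation reads r + λ⁻¹ G r = Y in weak form, and the minimum
equals ½ E[r Y] (`IsRidge.isResidual`, `IsRidge.objective_eq`). Testing the equations of two
parameters β, β' against each other's residual gives the exact identity F(β') - F(β) = (2λ)⁻¹ ⟨(G -
G') r, r'⟩ (`IsResidual.value_sub`). As r is Lipschitz in the kernel (`IsResidual.l2norm_sub_le`),
the derivative in β_j is (2λ)⁻¹ ⟨D r, r⟩, where D = -∂_{β_j} G is the product of |x_j - x'_j|^q and
the kernel G̃ built from -h', the profile of t μ(dt).

For the lower bound, suppose first that β vanishes off S. Then f sees only X_S, so Y may be replaced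
by its regression function on X_S, and independence of X_S and X_{Sᶜ} factors the form: ⟨D r, r⟩ =
E|X_j - X'_j|^q ⟨G̃ r, r⟩ (`Captures.le_pairing_kernelSlope`). Since (t - m_μ) μ(dt) is a positive
measure, ⟨G̃ r, r⟩ ≥ m_μ ⟨G r, r⟩ (`lowerEnd_mul_pairing_le`). Finally λ f is the kernel mean
embedding of r, so ⟨G r, r⟩ = λ² ‖f‖², and ‖f‖ controls the gap F(0) - F(β) = ½ E[Y f] by
Cauchy–Schwarz (`IsRidge.sq_gap_le`). The result is twice the main term of the theorem.

A general β is compared with the vector β₀ that agrees with β on S and vanishes elsewhere. The value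
and the form ⟨D r, r⟩ change by at most a multiple of ‖β_{Sᶜ}‖₁ (`IsRidge.abs_objective_sub_le`,
`IsRidge.abs_pairing_kernelSlope_sub_le`), and the spare factor 2 pays for (a + b)² ≤ 2a² + 2b² when
the gap at β is replaced by the gap at β₀ (`gradient_bound_of_estimates`). -/

namespace KRR

/-! ### Bilinear forms given by bounded kernels -/

section Pairing

variable {Ω : Type*} [MeasurableSpace Ω] {Q : Measure Ω} {G G' : Ω × Ω → ℝ} {u u' v v' : Ω → ℝ}

/-- The Cauchy–Schwarz inequality for square integrable functions. -/
theorem sq_integral_mul_le (hu : MemLp u 2 Q) (hv : MemLp v 2 Q) :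
    (∫ z, u z * v z ∂Q) ^ 2 ≤ (∫ z, u z ^ 2 ∂Q) * ∫ z, v z ^ 2 ∂Q := by
  have inner_eq : ∀ {a b : Ω → ℝ} (ha : MemLp a 2 Q) (hb : MemLp b 2 Q),
      inner ℝ (ha.toLp a) (hb.toLp b) = ∫ z, a z * b z ∂Q := by
    intro a b ha hb
    rw [L2.inner_def]
    refine integral_congr_ae ?_
    filter_upwards [ha.coeFn_toLp, hb.coeFn_toLp] with z h1 h2
    simp [h1, h2, mul_comm]
  have h := real_inner_mul_inner_self_le (hu.toLp u) (hv.toLp v)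
  simp only [inner_eq] at h
  simpa only [sq] using h

/-- The `L²` norm of a function. -/
noncomputable def l2norm (Q : Measure Ω) (u : Ω → ℝ) : ℝ := √(∫ z, u z ^ 2 ∂Q)

theorem l2norm_nonneg : 0 ≤ l2norm Q u := Real.sqrt_nonneg _

theorem l2norm_sq : l2norm Q u ^ 2 = ∫ z, u z ^ 2 ∂Q :=
  Real.sq_sqrt (integral_nonneg fun _ => sq_nonneg _)

theorem integral_abs_le_l2norm [IsProbabilityMeasure Q] (hu : MemLp u 2 Q) :
    ∫ z, |u z| ∂Q ≤ l2norm Q u := by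
  have h := sq_integral_mul_le (Q := Q) hu.abs (memLp_const (1 : ℝ))
  refine Real.le_sqrt_of_sq_le ?_
  simpa using h

/-- The bilinear form `(u, v) ↦ ∬ G(z, w) u(z) v(w) Q(dz) Q(dw)` of a kernel `G`. -/
noncomputable def pairing (Q : Measure Ω) (G : Ω × Ω → ℝ) (u v : Ω → ℝ) : ℝ :=
  ∫ p, G p * (u p.1 * v p.2) ∂Q.prod Q

theorem pairing_const_mul (c : ℝ) :
    pairing Q (fun p => c * G p) u v = c * pairing Q G u v := by
  rw [pairing, pairing, ← integral_const_mul]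
  simp only [mul_assoc]

theorem pairing_congr_kernel (h : G =ᵐ[Q.prod Q] G') : pairing Q G u v = pairing Q G' u v := by
  refine integral_congr_ae ?_
  filter_upwards [h] with p hp
  rw [hp]

theorem integrable_pairing [SFinite Q] (hG : MemLp G ⊤ (Q.prod Q)) (hu : Integrable u Q)
    (hv : Integrable v Q) : Integrable (fun p => G p * (u p.1 * v p.2)) (Q.prod Q) :=
  (hu.mul_prod hv).mul_of_top_right hG

variable [IsProbabilityMeasure Q]

/-- After bounding the kernel, the double integral splits into two L¹ norms, each at most the L²
norm under a probability measure. An almost sure bound on the kernel is enough, which matters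
because X is only almost surely bounded. -/
theorem abs_pairing_le {c : ℝ} (hc : ∀ᵐ p ∂Q.prod Q, |G p| ≤ c) (hu : MemLp u 2 Q)
    (hv : MemLp v 2 Q) : |pairing Q G u v| ≤ c * (l2norm Q u * l2norm Q v) := by
  have hc0 : 0 ≤ c := by
    obtain ⟨p, hp⟩ := hc.exists
    exact (abs_nonneg _).trans hp
  have hu1 := (hu.integrable one_le_two).abs
  have hv1 := (hv.integrable one_le_two).abs
  calc |pairing Q G u v| ≤ ∫ p, c * (|u p.1| * |v p.2|) ∂Q.prod Q := by
        rw [← Real.norm_eq_abs, pairing]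
        refine norm_integral_le_of_norm_le ((hu1.mul_prod hv1).const_mul c) ?_
        filter_upwards [hc] with p hp
        rw [Real.norm_eq_abs, abs_mul, abs_mul]
        gcongr
    _ = c * ((∫ z, |u z| ∂Q) * ∫ z, |v z| ∂Q) := by
        rw [integral_const_mul, integral_prod_mul (fun z => |u z|) (fun z => |v z|)]
    _ ≤ _ := by
        gcongr
        · exact l2norm_nonneg
        · exact integral_abs_le_l2norm hu
        · exact integral_abs_le_l2norm hv

theorem pairing_sub_kernel (hG : MemLp G ⊤ (Q.prod Q)) (hG' : MemLp G' ⊤ (Q.prod Q))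
    (hu : Integrable u Q) (hv : Integrable v Q) :
    pairing Q (fun p => G p - G' p) u v = pairing Q G u v - pairing Q G' u v := by
  rw [pairing, pairing, pairing, ← integral_sub (integrable_pairing hG hu hv)
    (integrable_pairing hG' hu hv)]
  simp only [sub_mul]

theorem pairing_sub_left (hG : MemLp G ⊤ (Q.prod Q))
    (hu : Integrable u Q) (hu' : Integrable u' Q) (hv : Integrable v Q) :
    pairing Q G (fun z => u z - u' z) v = pairing Q G u v - pairing Q G u' v := by
  rw [pairing, pairing, pairing, ← integral_sub (integrable_pairing hG hu hv)
    (integrable_pairing hG hu' hv)]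
  simp only [sub_mul, mul_sub]

theorem pairing_sub_right (hG : MemLp G ⊤ (Q.prod Q))
    (hu : Integrable u Q) (hv : Integrable v Q) (hv' : Integrable v' Q) :
    pairing Q G u (fun z => v z - v' z) = pairing Q G u v - pairing Q G u v' := by
  rw [pairing, pairing, pairing, ← integral_sub (integrable_pairing hG hu hv)
    (integrable_pairing hG hu hv')]
  simp only [mul_sub]

theorem pairing_swap (hsymm : ∀ z w, G (z, w) = G (w, z)) :
    pairing Q G u v = pairing Q G v u := by
  rw [pairing, pairing, ← integral_prod_swap]
  refine integral_congr_ae (Filter.Eventually.of_forall fun p => ?_)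
  simp only [Prod.fst_swap, Prod.snd_swap]
  rw [show G p.swap = G p from (hsymm p.1 p.2).symm]
  ring

theorem pairing_eq_integral_integral (hG : MemLp G ⊤ (Q.prod Q)) (hu : Integrable u Q)
    (hv : Integrable v Q) :
    pairing Q G u v = ∫ w, (∫ z, G (z, w) * u z ∂Q) * v w ∂Q := by
  rw [pairing, integral_prod_symm _ (integrable_pairing hG hu hv)]
  simp only [← integral_mul_const, mul_assoc]

end Pairing

/-! ### Solutions of the regularized normal equation -/

section NormalEquation

variable {Ω : Type*} [MeasurableSpace Ω] {Q : Measure Ω}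

/-- A bounded symmetric kernel with a positive semidefinite bilinear form. -/
structure IsPosKernel (Q : Measure Ω) (G : Ω × Ω → ℝ) : Prop where
  memLp : MemLp G ⊤ (Q.prod Q)
  symm : ∀ z w, G (z, w) = G (w, z)
  nonneg : ∀ u, MemLp u 2 Q → 0 ≤ pairing Q G u u

/-- `r` solves the equation `r + λ⁻¹ G r = y` in weak form. -/
structure IsResidual (Q : Measure Ω) (lam : ℝ) (y : Ω → ℝ) (G : Ω × Ω → ℝ) (r : Ω → ℝ) :
    Prop where
  memLp : MemLp r 2 Q
  weak : ∀ u, MemLp u 2 Q →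
    ∫ z, u z * r z ∂Q + lam⁻¹ * pairing Q G r u = ∫ z, u z * y z ∂Q

variable {lam : ℝ} {y : Ω → ℝ} {G G' : Ω × Ω → ℝ} {r r' : Ω → ℝ}

theorem IsResidual.integral_mul_eq (h : IsResidual Q lam y G r) :
    ∫ z, r z * y z ∂Q = l2norm Q r ^ 2 + lam⁻¹ * pairing Q G r r := by
  rw [← h.weak r h.memLp, l2norm_sq]
  simp only [sq]

theorem IsResidual.integral_mul_nonneg (hlam : 0 < lam) (hG : IsPosKernel Q G)
    (h : IsResidual Q lam y G r) : 0 ≤ ∫ z, r z * y z ∂Q := by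
  rw [h.integral_mul_eq]
  have := hG.nonneg r h.memLp
  positivity

theorem integral_mul_le_l2norm {u v : Ω → ℝ} (hu : MemLp u 2 Q) (hv : MemLp v 2 Q) :
    ∫ z, u z * v z ∂Q ≤ l2norm Q u * l2norm Q v := by
  refine le_of_sq_le_sq ?_ (mul_nonneg l2norm_nonneg l2norm_nonneg)
  rw [mul_pow, l2norm_sq, l2norm_sq]
  exact sq_integral_mul_le hu hv

/-- Energy estimate: testing with r itself and dropping the nonnegative form gives ‖r‖² ≤ ⟨r, y⟩ ≤
‖r‖ ‖y‖. -/
theorem IsResidual.l2norm_le (hlam : 0 < lam) (hy : MemLp y 2 Q) (hG : IsPosKernel Q G)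
    (h : IsResidual Q lam y G r) : l2norm Q r ≤ l2norm Q y := by
  have h1 := h.integral_mul_eq
  have h2 := integral_mul_le_l2norm h.memLp hy
  have h3 : 0 ≤ lam⁻¹ * pairing Q G r r := mul_nonneg (by positivity) (hG.nonneg r h.memLp)
  by_contra! hlt
  have h4 : 0 ≤ l2norm Q y := l2norm_nonneg
  nlinarith

variable [IsProbabilityMeasure Q]

/-- Each equation is tested with the residual of the other one. The common term ⟨r, r'⟩ cancels, and
symmetry of the second kernel lets the two forms be subtracted. The identity is exact, so
differentiating the value needs only first order information on the residual. -/
theorem IsResidual.value_sub (hG : IsPosKernel Q G) (hG' : IsPosKernel Q G')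
    (h : IsResidual Q lam y G r) (h' : IsResidual Q lam y G' r') :
    1 / 2 * ∫ z, r' z * y z ∂Q - 1 / 2 * ∫ z, r z * y z ∂Q
      = 1 / (2 * lam) * pairing Q (fun p => G p - G' p) r r' := by
  have hi := h.memLp.integrable one_le_two
  have hi' := h'.memLp.integrable one_le_two
  rw [pairing_sub_kernel hG.memLp hG'.memLp hi hi', pairing_swap (G := G') hG'.symm,
    ← h.weak r' h'.memLp, ← h'.weak r h.memLp]
  simp only [mul_comm (r' _) (r _)]
  ring

/-- The difference d = r' - r solves d + λ⁻¹ G' d = λ⁻¹ (G - G') r. Testing with d and using that G'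
is positive leaves ‖d‖² ≤ λ⁻¹ ⟨(G - G') r, d⟩, and ‖r‖ ≤ ‖y‖. -/
theorem IsResidual.l2norm_sub_le (hlam : 0 < lam) (hy : MemLp y 2 Q) (hG : IsPosKernel Q G)
    (hG' : IsPosKernel Q G') (h : IsResidual Q lam y G r) (h' : IsResidual Q lam y G' r')
    {c : ℝ} (hc : ∀ᵐ p ∂Q.prod Q, |G p - G' p| ≤ c) :
    l2norm Q (fun z => r' z - r z) ≤ lam⁻¹ * (c * l2norm Q y) := by
  have hi := h.memLp.integrable one_le_two
  have hi' := h'.memLp.integrable one_le_two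
  have hd : MemLp (fun z => r' z - r z) 2 Q := h'.memLp.sub h.memLp
  have hdi := hd.integrable one_le_two
  have hc0 : 0 ≤ c := by
    obtain ⟨p, hp⟩ := hc.exists
    exact (abs_nonneg _).trans hp
  have e1 : l2norm Q (fun z => r' z - r z) ^ 2
      = ∫ z, (r' z - r z) * r' z ∂Q - ∫ z, (r' z - r z) * r z ∂Q := by
    have i1 : Integrable (fun z => (r' z - r z) * r' z) Q := hd.integrable_mul h'.memLp
    have i2 : Integrable (fun z => (r' z - r z) * r z) Q := hd.integrable_mul h.memLp
    rw [l2norm_sq, ← integral_sub i1 i2]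
    congr 1
    funext z
    ring
  have e2 := h.weak _ hd
  have e3 := h'.weak _ hd
  have e4 := hG'.nonneg _ hd
  rw [pairing_sub_left hG'.memLp hi' hi hdi] at e4
  have e5 := pairing_sub_kernel hG.memLp hG'.memLp hi hdi
  have e6 := abs_pairing_le hc h.memLp hd
  have e7 := h.l2norm_le hlam hy hG
  have e8 : 0 ≤ l2norm Q (fun z => r' z - r z) := l2norm_nonneg
  set N := l2norm Q (fun z => r' z - r z)
  have hl : 0 < lam⁻¹ := by positivity
  have e9 : N ^ 2 ≤ lam⁻¹ * (c * l2norm Q y) * N := by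
    have : N ^ 2 ≤ lam⁻¹ * pairing Q (fun p => G p - G' p) r (fun z => r' z - r z) := by
      rw [e5, e1]
      nlinarith
    refine this.trans ?_
    rw [mul_assoc]
    gcongr
    refine (le_abs_self _).trans (e6.trans ?_)
    rw [mul_assoc]
    gcongr
  rcases e8.eq_or_lt with h0 | h0
  · rw [← h0]
    have : 0 ≤ l2norm Q y := l2norm_nonneg
    positivity
  · rw [sq] at e9
    exact le_of_mul_le_mul_right e9 h0

end NormalEquation


/-! ### The profile of a finite measure with bounded support -/

theorem abs_exp_neg_sub_exp_neg_le {x y : ℝ} (hx : 0 ≤ x) (hy : 0 ≤ y) :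
    |Real.exp (-x) - Real.exp (-y)| ≤ |x - y| := by
  wlog h : x ≤ y generalizing x y
  · rw [abs_sub_comm, abs_sub_comm x]
    exact this hy hx (le_of_not_ge h)
  have h1 : Real.exp (-y) = Real.exp (-x) * Real.exp (-(y - x)) := by
    rw [← Real.exp_add]
    ring_nf
  have h2 := Real.add_one_le_exp (-(y - x))
  have h3 : Real.exp (-x) ≤ 1 := by simpa using hx
  have h4 : Real.exp (-y) ≤ Real.exp (-x) := by simpa using h
  rw [abs_of_nonneg (by linarith), abs_of_nonpos (by linarith), h1]
  nlinarith [Real.exp_pos (-x)]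

/-- By convexity the tangent at y makes the remainder nonnegative, and the tangent at x bounds it by
(y - x)(e^{-x} - e^{-y}), to which the Lipschitz bound applies. -/
theorem abs_exp_neg_sub_exp_neg_sub_le {x y : ℝ} (hx : 0 ≤ x) (hy : 0 ≤ y) :
    |Real.exp (-x) - Real.exp (-y) - (y - x) * Real.exp (-y)| ≤ (x - y) ^ 2 := by
  have h1 : Real.exp (-x) = Real.exp (-y) * Real.exp (y - x) := by
    rw [← Real.exp_add]
    ring_nf
  have h1' : Real.exp (-y) = Real.exp (-x) * Real.exp (x - y) := by
    rw [← Real.exp_add]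
    ring_nf
  have h2 := Real.add_one_le_exp (y - x)
  have h2' := Real.add_one_le_exp (x - y)
  have h3 : 0 ≤ Real.exp (-x) - Real.exp (-y) - (y - x) * Real.exp (-y) := by
    rw [h1]
    nlinarith [Real.exp_pos (-y)]
  have h4 : Real.exp (-x) * (x - y + 1) ≤ Real.exp (-y) := by
    rw [h1']
    gcongr
  rw [abs_of_nonneg h3]
  have h5 := abs_exp_neg_sub_exp_neg_le hx hy
  have h6 : (Real.exp (-y) - Real.exp (-x)) * (x - y) ≤ (x - y) ^ 2 := by
    refine (le_abs_self _).trans ?_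
    rw [abs_mul, ← sq_abs (x - y), sq, abs_sub_comm]
    gcongr
  nlinarith

section Profile

variable {ν : Measure ℝ≥0}

theorem measurable_profile [SFinite ν] : Measurable (profile ν) := by
  have : StronglyMeasurable fun z : ℝ => ∫ t : ℝ≥0, Real.exp (-((t : ℝ) * z)) ∂ν := by
    refine StronglyMeasurable.integral_prod_right
      (f := fun (z : ℝ) (t : ℝ≥0) => Real.exp (-((t : ℝ) * z))) ?_
    exact Measurable.stronglyMeasurable (by fun_prop)
  exact this.measurable

theorem profile_zero : profile ν 0 = ν.real Set.univ := by
  simp [profile]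

theorem profile_nonneg {z : ℝ} : 0 ≤ profile ν z := integral_nonneg fun _ => (Real.exp_pos _).le

/-- The measure `t μ(dt)`. -/
noncomputable def moment (ν : Measure ℝ≥0) : Measure ℝ≥0 := ν.withDensity fun t => (t : ENNReal)

theorem profile_moment (z : ℝ) : profile (moment ν) z = ∫ t, t * Real.exp (-((t : ℝ) * z)) ∂ν := by
  rw [profile, moment, integral_withDensity_eq_integral_smul (f := fun t : ℝ≥0 => t) measurable_id]
  rfl

theorem ae_withDensity_le {f : ℝ≥0 → ENNReal} {T : ℝ} (hT : ∀ᵐ t : ℝ≥0 ∂ν, (t : ℝ) ≤ T) :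
    ∀ᵐ t : ℝ≥0 ∂ν.withDensity f, (t : ℝ) ≤ T :=
  (withDensity_absolutelyContinuous _ _).ae_le hT

variable [IsFiniteMeasure ν]

theorem integrable_exp_neg_mul {z : ℝ} (hz : 0 ≤ z) :
    Integrable (fun t : ℝ≥0 => Real.exp (-((t : ℝ) * z))) ν := by
  refine Integrable.of_bound (C := 1) (by fun_prop) (Filter.Eventually.of_forall fun t => ?_)
  simp only [Real.norm_eq_abs, Real.abs_exp, Real.exp_le_one_iff, Left.neg_nonpos_iff]
  positivity

theorem profile_le {z : ℝ} (hz : 0 ≤ z) : profile ν z ≤ ν.real Set.univ := by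
  rw [← profile_zero]
  refine integral_mono (integrable_exp_neg_mul hz) (integrable_exp_neg_mul le_rfl) fun t => ?_
  simp only [mul_zero, neg_zero, Real.exp_le_exp, Left.neg_nonpos_iff]
  positivity

theorem abs_profile_sub_le {T : ℝ} (hT : ∀ᵐ t : ℝ≥0 ∂ν, (t : ℝ) ≤ T) {a b : ℝ} (ha : 0 ≤ a)
    (hb : 0 ≤ b) : |profile ν a - profile ν b| ≤ T * ν.real Set.univ * |a - b| := by
  rw [profile, profile, ← integral_sub (integrable_exp_neg_mul ha) (integrable_exp_neg_mul hb),
    ← Real.norm_eq_abs]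
  refine (norm_integral_le_of_norm_le (integrable_const (T * |a - b|)) ?_).trans_eq ?_
  · filter_upwards [hT] with t ht
    refine (abs_exp_neg_sub_exp_neg_le (by positivity) (by positivity)).trans ?_
    rw [← mul_sub, abs_mul, NNReal.abs_eq]
    gcongr
  · rw [integral_const, smul_eq_mul]
    ring

theorem isFiniteMeasure_withDensity_of_le {f : ℝ≥0 → ℝ≥0} {T : ℝ} (hT : ∀ᵐ t : ℝ≥0 ∂ν, (f t : ℝ) ≤ T) :
    IsFiniteMeasure (ν.withDensity fun t => (f t : ENNReal)) := by
  refine isFiniteMeasure_withDensity (ne_of_lt ?_)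
  calc ∫⁻ t, f t ∂ν ≤ ∫⁻ _, ENNReal.ofReal T ∂ν := by
        refine lintegral_mono_ae ?_
        filter_upwards [hT] with t ht
        rw [← ENNReal.ofReal_coe_nnreal]
        exact ENNReal.ofReal_le_ofReal ht
    _ < ⊤ := by
        rw [lintegral_const]
        exact ENNReal.mul_lt_top ENNReal.ofReal_lt_top (measure_lt_top _ _)

theorem isFiniteMeasure_moment {T : ℝ} (hT : ∀ᵐ t : ℝ≥0 ∂ν, (t : ℝ) ≤ T) :
    IsFiniteMeasure (moment ν) := isFiniteMeasure_withDensity_of_le hT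

theorem integrable_mul_exp_neg_mul {T : ℝ} (hT : ∀ᵐ t : ℝ≥0 ∂ν, (t : ℝ) ≤ T) {z : ℝ} (hz : 0 ≤ z) :
    Integrable (fun t : ℝ≥0 => t * Real.exp (-((t : ℝ) * z))) ν := by
  refine Integrable.of_bound (C := T * 1) (by fun_prop) ?_
  filter_upwards [hT] with t ht
  rw [Real.norm_eq_abs, abs_mul, NNReal.abs_eq, Real.abs_exp]
  gcongr
  · exact t.2.trans ht
  · rw [Real.exp_le_one_iff, Left.neg_nonpos_iff]
    positivity

theorem moment_real_univ_le {T : ℝ} (hT : ∀ᵐ t : ℝ≥0 ∂ν, (t : ℝ) ≤ T) :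
    (moment ν).real Set.univ ≤ T * ν.real Set.univ := by
  rw [← profile_zero, profile_moment]
  calc ∫ t : ℝ≥0, (t : ℝ) * Real.exp (-((t : ℝ) * 0)) ∂ν ≤ ∫ _, T ∂ν := by
        refine integral_mono_ae (integrable_mul_exp_neg_mul hT le_rfl) (integrable_const _) ?_
        filter_upwards [hT] with t ht
        simpa using ht
    _ = T * ν.real Set.univ := by rw [integral_const, smul_eq_mul, mul_comm]

theorem abs_profile_sub_sub_le {T : ℝ} (hT : ∀ᵐ t : ℝ≥0 ∂ν, (t : ℝ) ≤ T) {a b : ℝ} (ha : 0 ≤ a)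
    (hb : 0 ≤ b) :
    |profile ν a - profile ν b - (b - a) * profile (moment ν) b|
      ≤ T ^ 2 * ν.real Set.univ * (a - b) ^ 2 := by
  have hi : Integrable
      (fun t : ℝ≥0 => Real.exp (-((t : ℝ) * a)) - Real.exp (-((t : ℝ) * b))) ν :=
    (integrable_exp_neg_mul ha).sub (integrable_exp_neg_mul hb)
  rw [profile_moment, profile, profile,
    ← integral_sub (integrable_exp_neg_mul ha) (integrable_exp_neg_mul hb), ← integral_const_mul,
    ← integral_sub hi ((integrable_mul_exp_neg_mul hT hb).const_mul _), ← Real.norm_eq_abs]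
  refine (norm_integral_le_of_norm_le (integrable_const (T ^ 2 * (a - b) ^ 2)) ?_).trans_eq ?_
  · filter_upwards [hT] with t ht
    have h := abs_exp_neg_sub_exp_neg_sub_le (x := t * a) (y := t * b) (by positivity)
      (by positivity)
    have e : (b - a) * ((t : ℝ) * Real.exp (-((t : ℝ) * b)))
      = (t * b - t * a) * Real.exp (-((t : ℝ) * b)) := by ring
    rw [Real.norm_eq_abs, e]
    refine h.trans ?_
    rw [← mul_sub, mul_pow]
    gcongr
  · rw [integral_const, smul_eq_mul]
    ring

/-- The profile of `(t - m) μ(dt)`, when `μ` lives on `[m, ∞)`. -/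
theorem profile_withDensity_sub {T : ℝ} (hT : ∀ᵐ t : ℝ≥0 ∂ν, (t : ℝ) ≤ T) {m : ℝ≥0}
    (hm : ∀ᵐ t ∂ν, m ≤ t) {z : ℝ} (hz : 0 ≤ z) :
    profile (ν.withDensity fun t => ((t - m : ℝ≥0) : ENNReal)) z
      = profile (moment ν) z - m * profile ν z := by
  rw [profile_moment, profile, profile, ← integral_const_mul,
    integral_withDensity_eq_integral_smul (f := fun t : ℝ≥0 => t - m) (by fun_prop),
    ← integral_sub (integrable_mul_exp_neg_mul hT hz) ((integrable_exp_neg_mul hz).const_mul _)]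
  refine integral_congr_ae ?_
  filter_upwards [hm] with t ht
  rw [NNReal.smul_def, NNReal.coe_sub ht, smul_eq_mul]
  ring

end Profile

theorem ae_lowerEnd_le {μ : Measure ℝ≥0} :
    ∀ᵐ t ∂μ, lowerEnd μ ≤ t := by
  filter_upwards [Measure.support_mem_ae (μ := μ)] with t ht
  exact csInf_le (OrderBot.bddBelow _) ht

theorem KernelAssumption.exists_ae_le {μ : Measure ℝ≥0} (h : KernelAssumption μ) :
    ∃ T : ℝ, 0 < T ∧ ∀ᵐ t : ℝ≥0 ∂μ, (t : ℝ) ≤ T := by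
  obtain ⟨T, hT⟩ := h.bddAbove
  refine ⟨T + 1, by positivity, ?_⟩
  filter_upwards [Measure.support_mem_ae (μ := μ)] with t ht
  have : (t : ℝ) ≤ T := by exact_mod_cast hT ht
  linarith

theorem KernelAssumption.real_univ_pos {μ : Measure ℝ≥0} [IsFiniteMeasure μ]
    (h : KernelAssumption μ) : 0 < μ.real Set.univ := by
  refine measureReal_nonneg.lt_of_ne' fun h0 => ?_
  have h1 : μ = 0 := by
    rw [← Measure.measure_univ_eq_zero]
    exact (measureReal_eq_zero_iff).1 h0
  have := h.lowerEnd_pos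
  simp [lowerEnd, h1] at this


/-! ### The kernel pulled back to the data space -/

section Kernel

variable {p : ℕ} (q : ℕ)

/-- The weighted distance `∑ β_i |x_i - x'_i|^q`. -/
noncomputable def weightedDist (β x x' : Fin p → ℝ) : ℝ := ∑ i, β i * |x i - x' i| ^ q

/-- The kernel `(z, z') ↦ h(∑ β_i |x_i - x'_i|^q)`. -/
noncomputable def pullback (ν : Measure ℝ≥0) (β : Fin p → ℝ) :
    ((Fin p → ℝ) × ℝ) × ((Fin p → ℝ) × ℝ) → ℝ :=
  fun w => profile ν (weightedDist q β w.1.1 w.2.1)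

variable {q} {β x x' : Fin p → ℝ} {ν : Measure ℝ≥0}

theorem weightedDist_nonneg (hβ : ∀ i, 0 ≤ β i) : 0 ≤ weightedDist q β x x' :=
  Finset.sum_nonneg fun i _ => mul_nonneg (hβ i) (by positivity)

theorem weightedDist_comm : weightedDist q β x x' = weightedDist q β x' x :=
  Finset.sum_congr rfl fun i _ => by rw [abs_sub_comm]

theorem measurable_weightedDist :
    Measurable fun w : ((Fin p → ℝ) × ℝ) × ((Fin p → ℝ) × ℝ) =>
      weightedDist q β w.1.1 w.2.1 := by
  unfold weightedDist
  fun_prop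

theorem measurable_pullback [SFinite ν] : Measurable (pullback q ν β) :=
  measurable_profile.comp measurable_weightedDist

theorem pullback_symm (z w : (Fin p → ℝ) × ℝ) : pullback q ν β (z, w) = pullback q ν β (w, z) := by
  simp only [pullback, weightedDist_comm (x := z.1)]

theorem abs_pullback_le [IsFiniteMeasure ν] (hβ : ∀ i, 0 ≤ β i)
    (w : ((Fin p → ℝ) × ℝ) × ((Fin p → ℝ) × ℝ)) : |pullback q ν β w| ≤ ν.real Set.univ := by
  rw [pullback, abs_of_nonneg profile_nonneg]
  exact profile_le (weightedDist_nonneg hβ)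

theorem memLp_pullback [IsFiniteMeasure ν] (hβ : ∀ i, 0 ≤ β i)
    (P : Measure (((Fin p → ℝ) × ℝ) × ((Fin p → ℝ) × ℝ))) : MemLp (pullback q ν β) ⊤ P :=
  memLp_top_of_bound measurable_pullback.aestronglyMeasurable _
    (Filter.Eventually.of_forall (abs_pullback_le hβ))

theorem measurable_scale : Measurable (scale q β) := by
  unfold scale
  fun_prop

/-- This is the reason for the exponent 1/q in the scaling: the argument of h becomes linear in β.
-/
theorem sum_abs_scale_sub (hq : q ≠ 0) (hβ : ∀ i, 0 ≤ β i) :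
    ∑ i, |scale q β x i - scale q β x' i| ^ q = weightedDist q β x x' := by
  refine Finset.sum_congr rfl fun i _ => ?_
  rw [scale, scale, ← mul_sub, abs_mul, mul_pow, abs_of_nonneg (Real.rpow_nonneg (hβ i) _),
    one_div, Real.rpow_inv_natCast_pow (hβ i) hq]

end Kernel

/-! ### The Hilbert space -/

section Hilbert

variable {p q : ℕ} [hq : Fact (q = 1 ∨ q = 2)] {ν : Measure ℝ≥0} [IsFiniteMeasure ν]

theorem inner_kerFun_one (g : Space ν q p) (x : Fin p → ℝ) :
    inner ℝ g (RKHS.kerFun (Space ν q p) x (1 : ℝ)) = g x := by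
  simp

theorem kerFun_one_apply (x x' : Fin p → ℝ) :
    RKHS.kerFun (Space ν q p) x (1 : ℝ) x' = profile ν (∑ i, |x i - x' i| ^ q) := by
  rw [RKHS.kerFun_apply, RKHS.OfKernel.kernel_ofKernel]
  simp [kernelMatrix, abs_sub_comm]

theorem norm_kerFun_one_sq (x : Fin p → ℝ) :
    ‖RKHS.kerFun (Space ν q p) x (1 : ℝ)‖ ^ 2 = ν.real Set.univ := by
  have hq0 : q ≠ 0 := by rcases hq.out with h | h <;> simp [h]
  rw [← real_inner_self_eq_norm_sq, inner_kerFun_one, kerFun_one_apply, ← profile_zero]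
  simp [hq0]

theorem sq_apply_le (g : Space ν q p) (x : Fin p → ℝ) :
    g x ^ 2 ≤ ν.real Set.univ * ‖g‖ ^ 2 := by
  rw [← inner_kerFun_one, ← norm_kerFun_one_sq (q := q) x, ← mul_pow, ← sq_abs]
  gcongr
  rw [mul_comm]
  exact abs_real_inner_le_norm _ _

theorem abs_apply_le (g : Space ν q p) (x : Fin p → ℝ) :
    |g x| ≤ √(ν.real Set.univ) * ‖g‖ := by
  refine abs_le_of_sq_le_sq ?_ (by positivity)
  rw [mul_pow, Real.sq_sqrt measureReal_nonneg]
  exact sq_apply_le g x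

/-- The feature map x ↦ k_x is continuous, because ‖k_x - k_{x₀}‖² = 2 (h(0) - h(‖x₀ - x‖_q^q)) and
h is Lipschitz on [0, ∞). This supplies the measurability needed to integrate elements of the space.
-/
theorem continuous_coe {T : ℝ} (hT : ∀ᵐ t : ℝ≥0 ∂ν, (t : ℝ) ≤ T) (g : Space ν q p) :
    Continuous g := by
  have hq0 : q ≠ 0 := by rcases hq.out with h | h <;> simp [h]
  suffices h : Continuous fun x => RKHS.kerFun (Space ν q p) x (1 : ℝ) by
    have : (g : (Fin p → ℝ) → ℝ)
        = fun x => inner ℝ g (RKHS.kerFun (Space ν q p) x (1 : ℝ)) := by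
      funext x
      rw [inner_kerFun_one]
    rw [this]
    fun_prop
  rw [continuous_iff_continuousAt]
  intro x₀
  rw [ContinuousAt, tendsto_iff_norm_sub_tendsto_zero]
  set c := T * ν.real Set.univ
  have key : ∀ x, ‖RKHS.kerFun (Space ν q p) x (1 : ℝ) - RKHS.kerFun (Space ν q p) x₀ (1 : ℝ)‖
      ≤ √(2 * (c * ∑ i, |x₀ i - x i| ^ q)) := by
    intro x
    refine Real.le_sqrt_of_sq_le ?_
    have hs : 0 ≤ ∑ i, |x₀ i - x i| ^ q := Finset.sum_nonneg fun i _ => by positivity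
    rw [norm_sub_sq_real, norm_kerFun_one_sq, norm_kerFun_one_sq, real_inner_comm,
      inner_kerFun_one, kerFun_one_apply]
    have h := abs_profile_sub_le hT (le_refl 0) hs
    rw [profile_zero, zero_sub, abs_neg, abs_of_nonneg hs] at h
    have := (abs_le.1 h).2
    linarith
  refine squeeze_zero (fun _ => norm_nonneg _) key ?_
  have hcont : Continuous fun x : Fin p → ℝ => √(2 * (c * ∑ i, |x₀ i - x i| ^ q)) := by fun_prop
  have := hcont.tendsto x₀
  simpa [hq0] using this

variable {β : Fin p → ℝ} {Q : Measure ((Fin p → ℝ) × ℝ)}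

theorem measurable_comp_scale {T : ℝ} (hT : ∀ᵐ t : ℝ≥0 ∂ν, (t : ℝ) ≤ T) (g : Space ν q p) :
    Measurable fun z : (Fin p → ℝ) × ℝ => g (scale q β z.1) :=
  (continuous_coe hT g).measurable.comp (measurable_scale.comp measurable_fst)

/-- The reproducing property turns the mean embedding of u, evaluated at the scaled data, into the
integral operator of the pulled back kernel. It is the passage from the Hilbert space to L²(Q). -/
theorem embedding_apply (hβ : ∀ i, 0 ≤ β i) {u : (Fin p → ℝ) × ℝ → ℝ} {φ : Space ν q p}
    (hφ : ∀ g : Space ν q p, inner ℝ φ g = ∫ z, u z * g (scale q β z.1) ∂Q)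
    (w : (Fin p → ℝ) × ℝ) :
    φ (scale q β w.1) = ∫ z, pullback q ν β (z, w) * u z ∂Q := by
  have hq0 : q ≠ 0 := by rcases hq.out with h | h <;> simp [h]
  rw [← inner_kerFun_one, hφ]
  refine integral_congr_ae (Filter.Eventually.of_forall fun z => ?_)
  simp only [kerFun_one_apply, sum_abs_scale_sub hq0 hβ, pullback]
  rw [weightedDist_comm, mul_comm]

variable [IsProbabilityMeasure Q]

theorem memLp_comp_scale {T : ℝ} (hT : ∀ᵐ t : ℝ≥0 ∂ν, (t : ℝ) ≤ T) (g : Space ν q p)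
    (r : ENNReal) : MemLp (fun z : (Fin p → ℝ) × ℝ => g (scale q β z.1)) r Q :=
  MemLp.of_bound (measurable_comp_scale hT g).aestronglyMeasurable _
    (Filter.Eventually.of_forall fun _ => abs_apply_le g _)

theorem integrable_mul_comp_scale {T : ℝ} (hT : ∀ᵐ t : ℝ≥0 ∂ν, (t : ℝ) ≤ T) (g : Space ν q p)
    {u : (Fin p → ℝ) × ℝ → ℝ} (hu : Integrable u Q) :
    Integrable (fun z => u z * g (scale q β z.1)) Q :=
  hu.mul_of_top_left (memLp_comp_scale hT g ⊤)

/-- The kernel mean embedding of the signed measure with density `u`. -/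
theorem exists_embedding {T : ℝ} (hT : ∀ᵐ t : ℝ≥0 ∂ν, (t : ℝ) ≤ T) (β : Fin p → ℝ)
    {u : (Fin p → ℝ) × ℝ → ℝ} (hu : Integrable u Q) :
    ∃ φ : Space ν q p, ∀ g, inner ℝ φ g = ∫ z, u z * g (scale q β z.1) ∂Q := by
  let L : Space ν q p →ₗ[ℝ] ℝ :=
    { toFun := fun g => ∫ z, u z * g (scale q β z.1) ∂Q
      map_add' := fun g g' => by
        rw [← integral_add (integrable_mul_comp_scale hT g hu)
          (integrable_mul_comp_scale hT g' hu)]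
        simp [mul_add]
      map_smul' := fun a g => by
        rw [RingHom.id_apply, smul_eq_mul, ← integral_const_mul]
        simp [mul_left_comm] }
  let L' : Space ν q p →L[ℝ] ℝ := L.mkContinuous ((∫ z, |u z| ∂Q) * √(ν.real Set.univ)) fun g => by
    refine (norm_integral_le_of_norm_le (hu.abs.mul_const (√(ν.real Set.univ) * ‖g‖))
      (Filter.Eventually.of_forall fun z => ?_)).trans_eq ?_
    · rw [Real.norm_eq_abs, abs_mul]
      gcongr
      exact abs_apply_le g _
    · rw [integral_mul_const, mul_assoc]
  exact ⟨(InnerProductSpace.toDual ℝ _).symm L', fun g => by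
    rw [InnerProductSpace.toDual_symm_apply]
    rfl⟩

theorem pairing_eq_integral_embedding (hβ : ∀ i, 0 ≤ β i) {u v : (Fin p → ℝ) × ℝ → ℝ}
    (hu : Integrable u Q) (hv : Integrable v Q) {φ : Space ν q p}
    (hφ : ∀ g : Space ν q p, inner ℝ φ g = ∫ z, u z * g (scale q β z.1) ∂Q) :
    pairing Q (pullback q ν β) u v = ∫ w, v w * φ (scale q β w.1) ∂Q := by
  rw [pairing_eq_integral_integral (memLp_pullback hβ _) hu hv]
  simp only [← embedding_apply hβ hφ, mul_comm (v _)]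

/-- The quadratic form at u is the squared norm of the mean embedding of u. -/
theorem isPosKernel_pullback {T : ℝ} (hT : ∀ᵐ t : ℝ≥0 ∂ν, (t : ℝ) ≤ T) (hβ : ∀ i, 0 ≤ β i) :
    IsPosKernel Q (pullback q ν β) where
  memLp := memLp_pullback hβ _
  symm := pullback_symm
  nonneg u hu := by
    have hui := hu.integrable one_le_two
    obtain ⟨φ, hφ⟩ := exists_embedding (q := q) hT β hui
    rw [pairing_eq_integral_embedding hβ hui hui hφ, ← hφ]
    exact real_inner_self_nonneg

/-- The normal equation of kernel ridge regression is solvable. -/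
theorem exists_normal_equation {T : ℝ} (hT : ∀ᵐ t : ℝ≥0 ∂ν, (t : ℝ) ≤ T) (β : Fin p → ℝ)
    {lam : ℝ} (hlam : 0 < lam) {y : (Fin p → ℝ) × ℝ → ℝ} (hy : Integrable y Q) :
    ∃ f : Space ν q p, ∀ g, lam * inner ℝ f g
      = ∫ z, (y z - f (scale q β z.1)) * g (scale q β z.1) ∂Q := by
  have hint : ∀ f g : Space ν q p,
      Integrable (fun z => f (scale q β z.1) * g (scale q β z.1)) Q := fun f g =>
    integrable_mul_comp_scale hT g ((memLp_comp_scale hT f 1).integrable le_rfl)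
  let B₀ : Space ν q p →ₗ[ℝ] Space ν q p →ₗ[ℝ] ℝ :=
    LinearMap.mk₂ ℝ (fun f g => lam * inner ℝ f g
      + ∫ z, f (scale q β z.1) * g (scale q β z.1) ∂Q)
      (fun f f' g => by
        simp only [RKHS.coe_add, Pi.add_apply, add_mul, inner_add_left]
        rw [integral_add (hint _ _) (hint _ _)]
        ring)
      (fun c f g => by
        simp only [RKHS.coe_smul, Pi.smul_apply, smul_eq_mul, mul_assoc, real_inner_smul_left,
          integral_const_mul]
        ring)
      (fun f g g' => by
        simp only [RKHS.coe_add, Pi.add_apply, mul_add, inner_add_right]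
        rw [integral_add (hint _ _) (hint _ _)]
        ring)
      (fun c f g => by
        simp only [RKHS.coe_smul, Pi.smul_apply, smul_eq_mul, mul_left_comm _ c,
          real_inner_smul_right, integral_const_mul]
        ring)
  let B : Space ν q p →L[ℝ] Space ν q p →L[ℝ] ℝ :=
    B₀.mkContinuous₂ (lam + ν.real Set.univ) fun f g => by
      have h1 : |∫ z, f (scale q β z.1) * g (scale q β z.1) ∂Q|
          ≤ ν.real Set.univ * ‖f‖ * ‖g‖ := by
        rw [← Real.norm_eq_abs]
        refine (norm_integral_le_of_norm_le
          (integrable_const ((√(ν.real Set.univ) * ‖f‖) * (√(ν.real Set.univ) * ‖g‖)))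
          (Filter.Eventually.of_forall fun z => ?_)).trans_eq ?_
        · rw [Real.norm_eq_abs, abs_mul]
          exact mul_le_mul (abs_apply_le f _) (abs_apply_le g _) (abs_nonneg _) (by positivity)
        · rw [integral_const, probReal_univ, one_smul, mul_mul_mul_comm,
            Real.mul_self_sqrt measureReal_nonneg, mul_assoc]
      have h2 : |lam * inner ℝ f g| ≤ lam * ‖f‖ * ‖g‖ := by
        rw [abs_mul, abs_of_pos hlam, mul_assoc]
        gcongr
        exact abs_real_inner_le_norm f g
      calc |lam * inner ℝ f g + ∫ z, f (scale q β z.1) * g (scale q β z.1) ∂Q| ≤ _ :=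
            abs_add_le _ _
        _ ≤ lam * ‖f‖ * ‖g‖ + ν.real Set.univ * ‖f‖ * ‖g‖ := add_le_add h2 h1
        _ = _ := by ring
  have hB : ∀ f g, B f g = lam * inner ℝ f g
      + ∫ z, f (scale q β z.1) * g (scale q β z.1) ∂Q := fun f g => rfl
  -- Lax–Milgram: the ridge term alone makes the form coercive, with constant `lam`; the solution is
  -- the preimage of the mean embedding of y.
  have hco : IsCoercive B := by
    refine ⟨lam, hlam, fun f => ?_⟩
    rw [hB, real_inner_self_eq_norm_mul_norm, mul_assoc]
    exact le_add_of_nonneg_right (integral_nonneg fun z => mul_self_nonneg _)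
  obtain ⟨φ, hφ⟩ := exists_embedding (q := q) hT β hy
  refine ⟨hco.continuousLinearEquivOfBilin.symm φ, fun g => ?_⟩
  have h := hco.continuousLinearEquivOfBilin_apply (hco.continuousLinearEquivOfBilin.symm φ) g
  rw [ContinuousLinearEquiv.apply_symm_apply, hφ, hB] at h
  simp only [sub_mul]
  rw [integral_sub (integrable_mul_comp_scale hT g hy) (hint _ _), h]
  ring

end Hilbert


/-! ### The minimizer of the objective -/

section Minimizer

variable {p q : ℕ} [hq : Fact (q = 1 ∨ q = 2)] {μ : Measure ℝ≥0} [IsFiniteMeasure μ]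
  {β : Fin p → ℝ} {Q : Measure ((Fin p → ℝ) × ℝ)} [IsProbabilityMeasure Q] {lam T : ℝ}

/-- The residual of the regression function `f`. -/
noncomputable def residual (q : ℕ) [Fact (q = 1 ∨ q = 2)] (β : Fin p → ℝ) (f : Space μ q p) :
    (Fin p → ℝ) × ℝ → ℝ := fun z => z.2 - f (scale q β z.1)

theorem memLp_residual (hT : ∀ᵐ t : ℝ≥0 ∂μ, (t : ℝ) ≤ T)
    (hY : MemLp (fun z : (Fin p → ℝ) × ℝ => z.2) 2 Q) (f : Space μ q p) :
    MemLp (residual q β f) 2 Q := hY.sub (memLp_comp_scale hT f 2)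

/-- `f` solves the normal equation of kernel ridge regression. -/
def IsRidge (lam : ℝ) (Q : Measure ((Fin p → ℝ) × ℝ)) (β : Fin p → ℝ) (f : Space μ q p) : Prop :=
  ∀ g : Space μ q p, lam * inner ℝ f g = ∫ z, residual q β f z * g (scale q β z.1) ∂Q

theorem exists_isRidge (hT : ∀ᵐ t : ℝ≥0 ∂μ, (t : ℝ) ≤ T) (β : Fin p → ℝ) (hlam : 0 < lam)
    (hY : MemLp (fun z : (Fin p → ℝ) × ℝ => z.2) 2 Q) :
    ∃ f : Space μ q p, IsRidge lam Q β f :=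
  exists_normal_equation hT β hlam (hY.integrable one_le_two)

/-- The normal equation says exactly that λ f is the mean embedding of the residual. -/
theorem IsRidge.integral_mul_eq_pairing {f : Space μ q p} (h : IsRidge lam Q β f)
    (hT : ∀ᵐ t : ℝ≥0 ∂μ, (t : ℝ) ≤ T) (hlam : 0 < lam) (hβ : ∀ i, 0 ≤ β i)
    (hY : MemLp (fun z : (Fin p → ℝ) × ℝ => z.2) 2 Q)
    {u : (Fin p → ℝ) × ℝ → ℝ} (hu : Integrable u Q) :
    ∫ z, u z * f (scale q β z.1) ∂Q
      = lam⁻¹ * pairing Q (pullback q μ β) (residual q β f) u := by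
  have hφ : ∀ g : Space μ q p, inner ℝ (lam • f) g
      = ∫ z, residual q β f z * g (scale q β z.1) ∂Q := fun g => by
    rw [real_inner_smul_left, h g]
  rw [pairing_eq_integral_embedding hβ ((memLp_residual hT hY f).integrable one_le_two) hu hφ]
  simp only [RKHS.coe_smul, Pi.smul_apply, smul_eq_mul, mul_left_comm _ lam, integral_const_mul]
  rw [mul_inv_cancel_left₀ hlam.ne']

theorem IsRidge.isResidual {f : Space μ q p} (h : IsRidge lam Q β f)
    (hT : ∀ᵐ t : ℝ≥0 ∂μ, (t : ℝ) ≤ T) (hlam : 0 < lam) (hβ : ∀ i, 0 ≤ β i)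
    (hY : MemLp (fun z : (Fin p → ℝ) × ℝ => z.2) 2 Q) :
    IsResidual Q lam (fun z => z.2) (pullback q μ β) (residual q β f) where
  memLp := memLp_residual hT hY f
  weak u hu := by
    have hui := hu.integrable one_le_two
    have i1 : Integrable (fun z : (Fin p → ℝ) × ℝ => u z * z.2) Q := hu.integrable_mul hY
    rw [← h.integral_mul_eq_pairing hT hlam hβ hY hui]
    simp only [residual, mul_sub]
    rw [integral_sub i1 (integrable_mul_comp_scale hT f hui), sub_add_cancel]

theorem IsRidge.lam_mul_norm_sq {f : Space μ q p} (h : IsRidge lam Q β f)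
    (hT : ∀ᵐ t : ℝ≥0 ∂μ, (t : ℝ) ≤ T) (hlam : 0 < lam) (hβ : ∀ i, 0 ≤ β i)
    (hY : MemLp (fun z : (Fin p → ℝ) × ℝ => z.2) 2 Q) :
    lam ^ 2 * ‖f‖ ^ 2 = pairing Q (pullback q μ β) (residual q β f) (residual q β f) := by
  have h1 := h f
  rw [h.integral_mul_eq_pairing hT hlam hβ hY ((memLp_residual hT hY f).integrable one_le_two),
    real_inner_self_eq_norm_sq] at h1
  field_simp at h1
  linarith

/-- Expanding the functional around f, the normal equation cancels the linear terms and leaves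
nonnegative squares, so f attains the infimum. Testing the normal equation with f then gives λ ‖f‖²
= ⟨r, f⟩, which merges the loss and the penalty into ½ ⟨r, Y⟩. -/
theorem IsRidge.objective_eq {f : Space μ q p} (h : IsRidge lam Q β f)
    (hT : ∀ᵐ t : ℝ≥0 ∂μ, (t : ℝ) ≤ T) (hlam : 0 < lam)
    (hY : MemLp (fun z : (Fin p → ℝ) × ℝ => z.2) 2 Q) :
    objective μ q lam Q β = 1 / 2 * ∫ z, residual q β f z * z.2 ∂Q := by
  have hr := memLp_residual (q := q) (β := β) hT hY f
  have hri := hr.integrable one_le_two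
  have min : ∀ g : Space μ q p,
      1 / 2 * ∫ z, residual q β f z ^ 2 ∂Q + lam / 2 * ‖f‖ ^ 2
        ≤ 1 / 2 * ∫ z, residual q β g z ^ 2 ∂Q + lam / 2 * ‖g‖ ^ 2 := by
    intro g
    have hd := memLp_comp_scale (q := q) (β := β) (Q := Q) hT (g - f) 2
    have i1 := hr.integrable_sq
    have i2 := integrable_mul_comp_scale (β := β) hT (g - f) hri
    have i3 := hd.integrable_sq
    have e : ∫ z, residual q β g z ^ 2 ∂Q = ∫ z, residual q β f z ^ 2 ∂Q
        - 2 * ∫ z, residual q β f z * (g - f) (scale q β z.1) ∂Q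
        + ∫ z, (g - f) (scale q β z.1) ^ 2 ∂Q := by
      have i4 : Integrable (fun z => residual q β f z ^ 2
          - 2 * (residual q β f z * (g - f) (scale q β z.1))) Q := i1.sub (i2.const_mul 2)
      rw [← integral_const_mul, ← integral_sub i1 (i2.const_mul 2), ← integral_add i4 i3]
      congr 1
      funext z
      simp only [residual, RKHS.coe_sub, Pi.sub_apply]
      ring
    have hpos : 0 ≤ ∫ z, (g - f) (scale q β z.1) ^ 2 ∂Q := integral_nonneg fun _ => sq_nonneg _
    have hn : ‖g‖ ^ 2 = ‖f‖ ^ 2 + 2 * inner ℝ f (g - f) + ‖g - f‖ ^ 2 := by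
      rw [← norm_add_sq_real, add_sub_cancel]
    rw [e, hn, ← h (g - f)]
    nlinarith [sq_nonneg ‖g - f‖]
  have hval : objective μ q lam Q β
      = 1 / 2 * ∫ z, residual q β f z ^ 2 ∂Q + lam / 2 * ‖f‖ ^ 2 :=
    le_antisymm (ciInf_le ⟨_, Set.forall_mem_range.2 min⟩ f) (le_ciInf min)
  have i1 : Integrable (fun z : (Fin p → ℝ) × ℝ => residual q β f z * z.2) Q :=
    hr.integrable_mul hY
  have e : ∫ z, residual q β f z ^ 2 ∂Q
      = ∫ z, residual q β f z * z.2 ∂Q - ∫ z, residual q β f z * f (scale q β z.1) ∂Q := by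
    rw [← integral_sub i1 (integrable_mul_comp_scale hT f hri)]
    congr 1
    funext z
    simp only [residual]
    ring
  rw [hval, e, ← h f, real_inner_self_eq_norm_sq]
  ring

/-- Here ½ E[Y²] plays the role of F(0) (see `objective_zero`). The gap is ½ E[Y f], Cauchy–Schwarz
applies, E[f²] ≤ h(0) ‖f‖², and λ² ‖f‖² is the quadratic form at the residual. -/
theorem IsRidge.sq_gap_le {f : Space μ q p} (h : IsRidge lam Q β f)
    (hT : ∀ᵐ t : ℝ≥0 ∂μ, (t : ℝ) ≤ T) (hlam : 0 < lam) (hβ : ∀ i, 0 ≤ β i)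
    (hY : MemLp (fun z : (Fin p → ℝ) × ℝ => z.2) 2 Q) :
    4 * lam ^ 2 * (1 / 2 * ∫ z, z.2 ^ 2 ∂Q - objective μ q lam Q β) ^ 2
      ≤ (∫ z, z.2 ^ 2 ∂Q) * (μ.real Set.univ
        * pairing Q (pullback q μ β) (residual q β f) (residual q β f)) := by
  have hf := memLp_comp_scale (q := q) (β := β) (Q := Q) hT f 2
  have i1 : Integrable (fun z : (Fin p → ℝ) × ℝ => residual q β f z * z.2) Q :=
    (memLp_residual hT hY f).integrable_mul hY
  have e : 1 / 2 * ∫ z, z.2 ^ 2 ∂Q - objective μ q lam Q β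
      = 1 / 2 * ∫ z, z.2 * f (scale q β z.1) ∂Q := by
    rw [h.objective_eq hT hlam hY, ← mul_sub, ← integral_sub hY.integrable_sq i1]
    congr 2
    funext z
    simp only [residual]
    ring
  have h1 := sq_integral_mul_le hY hf
  have h2 : ∫ z, f (scale q β z.1) ^ 2 ∂Q ≤ μ.real Set.univ * ‖f‖ ^ 2 := by
    refine (integral_mono hf.integrable_sq (integrable_const _)
      fun z => sq_apply_le f (scale q β z.1)).trans_eq ?_
    simp
  have h3 : 0 ≤ ∫ z, z.2 ^ 2 ∂Q := integral_nonneg fun _ => sq_nonneg _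
  rw [e, ← h.lam_mul_norm_sq hT hlam hβ hY]
  calc 4 * lam ^ 2 * (1 / 2 * ∫ z, z.2 * f (scale q β z.1) ∂Q) ^ 2
      = lam ^ 2 * (∫ z, z.2 * f (scale q β z.1) ∂Q) ^ 2 := by ring
    _ ≤ lam ^ 2 * ((∫ z, z.2 ^ 2 ∂Q) * (μ.real Set.univ * ‖f‖ ^ 2)) := by
        gcongr
        exact h1.trans (by gcongr)
    _ = _ := by ring

/-- At β = 0 the prediction is the constant f(0). Testing with 1, as Y is centered, yields (1 + λ⁻¹
h(0)) f(0) = 0, so the residual is Y. -/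
theorem objective_zero (hT : ∀ᵐ t : ℝ≥0 ∂μ, (t : ℝ) ≤ T) (hlam : 0 < lam)
    (hY : MemLp (fun z : (Fin p → ℝ) × ℝ => z.2) 2 Q) (hc : ∫ z, z.2 ∂Q = 0) :
    objective μ q lam Q 0 = 1 / 2 * ∫ z, z.2 ^ 2 ∂Q := by
  have hq0 : q ≠ 0 := by rcases hq.out with h | h <;> simp [h]
  obtain ⟨f, hf⟩ := exists_isRidge (q := q) hT 0 hlam hY
  have hs : ∀ x : Fin p → ℝ, scale q 0 x = 0 := fun x => by
    funext i
    simp [scale, hq0]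
  have hr : ∀ z, residual q 0 f z = z.2 - f 0 := fun z => by rw [residual, hs]
  have hw := (hf.isResidual hT hlam (fun _ => le_rfl) hY).weak (fun _ => 1) (memLp_const _)
  have hG : pairing Q (pullback q μ 0) (residual q 0 f) (fun _ => 1)
      = μ.real Set.univ * ∫ z, residual q 0 f z ∂Q := by
    simp only [pairing, pullback, weightedDist, Pi.zero_apply, zero_mul, Finset.sum_const_zero,
      profile_zero, integral_const_mul]
    rw [integral_prod_mul (residual q 0 f) (fun _ => (1 : ℝ))]
    simp
  have hri : ∫ z, residual q 0 f z ∂Q = - f 0 := by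
    simp only [hr]
    rw [integral_sub (hY.integrable one_le_two) (integrable_const _), hc]
    simp
  simp only [hG, one_mul, hri, hc] at hw
  have h0 : f 0 = 0 := by
    have : (1 + lam⁻¹ * μ.real Set.univ) * f 0 = 0 := by linarith
    rcases mul_eq_zero.1 this with h | h
    · have : 0 ≤ lam⁻¹ * μ.real Set.univ := by positivity
      linarith
    · exact h
  rw [hf.objective_eq hT hlam hY]
  simp only [hr, h0, sub_zero, sq]

end Minimizer


/-! ### The derivative of the objective -/

theorem hasDerivWithinAt_of_abs_le_sq {f : ℝ → ℝ} {s : Set ℝ} {a D C : ℝ}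
    (h : ∀ b ∈ s, |f b - f a - (b - a) * D| ≤ C * (b - a) ^ 2) : HasDerivWithinAt f D s a := by
  rw [hasDerivWithinAt_iff_isLittleO]
  have h1 : (fun b => f b - f a - (b - a) • D) =O[nhdsWithin a s] fun b => ‖b - a‖ ^ 2 := by
    refine Asymptotics.IsBigO.of_bound C ?_
    filter_upwards [self_mem_nhdsWithin] with b hb
    simpa using h b hb
  exact h1.trans_isLittleO ((Asymptotics.isLittleO_pow_sub_sub a one_lt_two).mono
    nhdsWithin_le_nhds)

theorem abs_weightedDist_sub_le {p q : ℕ} {R : ℝ} {β β' x x' : Fin p → ℝ}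
    (hR : ∀ i, |x i - x' i| ^ q ≤ R) :
    |weightedDist q β x x' - weightedDist q β' x x'| ≤ R * ∑ i, |β i - β' i| := by
  rw [weightedDist, weightedDist, ← Finset.sum_sub_distrib, Finset.mul_sum]
  refine (Finset.abs_sum_le_sum_abs _ _).trans (Finset.sum_le_sum fun i _ => ?_)
  rw [← sub_mul, abs_mul, abs_of_nonneg (by positivity : 0 ≤ |x i - x' i| ^ q), mul_comm]
  gcongr
  exact hR i

theorem weightedDist_update {p q : ℕ} (β x x' : Fin p → ℝ) (j : Fin p) (b : ℝ) :
    weightedDist q (Function.update β j b) x x'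
      = weightedDist q β x x' + (b - β j) * |x j - x' j| ^ q := by
  rw [weightedDist, weightedDist, ← Finset.add_sum_erase _ _ (Finset.mem_univ j),
    ← Finset.add_sum_erase (a := j) _ (fun i => β i * |x i - x' i| ^ q) (Finset.mem_univ j),
    Function.update_self]
  rw [Finset.sum_congr rfl fun i hi => by rw [Function.update_of_ne (Finset.ne_of_mem_erase hi)]]
  ring

section Derivative

variable {p q : ℕ} [hq : Fact (q = 1 ∨ q = 2)] {Q : Measure ((Fin p → ℝ) × ℝ)}
  {MX : ℝ}

/-- The summand 1 makes the base at least 1, so that the square dominates both admissible powers and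
the bound does not depend on q. -/
theorem ae_abs_sub_pow_le (hX : ∀ᵐ z ∂Q, ‖z.1‖ ≤ MX) :
    ∀ᵐ w ∂Q.prod Q, ∀ i, |w.1.1 i - w.2.1 i| ^ q ≤ (1 + 2 * |MX|) ^ 2 := by
  have h1 : ∀ᵐ w ∂Q.prod Q, ‖w.1.1‖ ≤ MX := Measure.quasiMeasurePreserving_fst.ae hX
  have h2 : ∀ᵐ w ∂Q.prod Q, ‖w.2.1‖ ≤ MX := Measure.quasiMeasurePreserving_snd.ae hX
  filter_upwards [h1, h2] with w hw1 hw2 i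
  have h3 : |w.1.1 i - w.2.1 i| ≤ 1 + 2 * |MX| := by
    have e1 := norm_le_pi_norm w.1.1 i
    have e2 := norm_le_pi_norm w.2.1 i
    rw [Real.norm_eq_abs] at e1 e2
    have := abs_sub (w.1.1 i) (w.2.1 i)
    have := le_abs_self MX
    linarith
  have h4 : (1 : ℝ) ≤ 1 + 2 * |MX| := by linarith [abs_nonneg MX]
  calc |w.1.1 i - w.2.1 i| ^ q ≤ (1 + 2 * |MX|) ^ q := by gcongr
    _ ≤ (1 + 2 * |MX|) ^ 2 := by
        refine pow_le_pow_right₀ h4 ?_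
        rcases hq.out with h | h <;> omega

/-- Minus the derivative of the kernel with respect to `β_j`. -/
noncomputable def kernelSlope (q : ℕ) (μ : Measure ℝ≥0) (β : Fin p → ℝ) (j : Fin p) :
    ((Fin p → ℝ) × ℝ) × ((Fin p → ℝ) × ℝ) → ℝ :=
  fun w => pullback q (moment μ) β w * |w.1.1 j - w.2.1 j| ^ q

variable {μ : Measure ℝ≥0} [IsFiniteMeasure μ] {β β' : Fin p → ℝ} {lam T : ℝ}

theorem ae_abs_pullback_sub_le (hT : ∀ᵐ t : ℝ≥0 ∂μ, (t : ℝ) ≤ T) (hT0 : 0 < T)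
    (hX : ∀ᵐ z ∂Q, ‖z.1‖ ≤ MX) (hβ : ∀ i, 0 ≤ β i) (hβ' : ∀ i, 0 ≤ β' i) :
    ∀ᵐ w ∂Q.prod Q, |pullback q μ β w - pullback q μ β' w|
      ≤ T * μ.real Set.univ * ((1 + 2 * |MX|) ^ 2 * ∑ i, |β i - β' i|) := by
  filter_upwards [ae_abs_sub_pow_le (q := q) hX] with w hw
  refine (abs_profile_sub_le hT (weightedDist_nonneg hβ) (weightedDist_nonneg hβ')).trans ?_
  gcongr
  exact abs_weightedDist_sub_le hw

theorem ae_abs_kernelSlope_le (hT : ∀ᵐ t : ℝ≥0 ∂μ, (t : ℝ) ≤ T) (hT0 : 0 < T)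
    (hX : ∀ᵐ z ∂Q, ‖z.1‖ ≤ MX) (hβ : ∀ i, 0 ≤ β i) (j : Fin p) :
    ∀ᵐ w ∂Q.prod Q, |kernelSlope q μ β j w| ≤ T * μ.real Set.univ * (1 + 2 * |MX|) ^ 2 := by
  have := isFiniteMeasure_moment hT
  filter_upwards [ae_abs_sub_pow_le (q := q) hX] with w hw
  have h := moment_real_univ_le hT
  rw [kernelSlope, abs_mul, abs_of_nonneg (by positivity : 0 ≤ |w.1.1 j - w.2.1 j| ^ q)]
  gcongr
  · exact (abs_pullback_le hβ w).trans h
  · exact hw j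

theorem memLp_kernelSlope (hT : ∀ᵐ t : ℝ≥0 ∂μ, (t : ℝ) ≤ T) (hT0 : 0 < T)
    (hX : ∀ᵐ z ∂Q, ‖z.1‖ ≤ MX) (hβ : ∀ i, 0 ≤ β i) (j : Fin p) :
    MemLp (kernelSlope q μ β j) ⊤ (Q.prod Q) := by
  have := isFiniteMeasure_moment hT
  refine memLp_top_of_bound ?_ _ (ae_abs_kernelSlope_le hT hT0 hX hβ j)
  refine Measurable.aestronglyMeasurable (Measurable.mul measurable_pullback ?_)
  fun_prop

theorem ae_abs_kernelSlope_sub_le (hT : ∀ᵐ t : ℝ≥0 ∂μ, (t : ℝ) ≤ T) (hT0 : 0 < T)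
    (hX : ∀ᵐ z ∂Q, ‖z.1‖ ≤ MX) (hβ : ∀ i, 0 ≤ β i) (hβ' : ∀ i, 0 ≤ β' i) (j : Fin p) :
    ∀ᵐ w ∂Q.prod Q, |kernelSlope q μ β j w - kernelSlope q μ β' j w|
      ≤ T ^ 2 * μ.real Set.univ * ((1 + 2 * |MX|) ^ 2) ^ 2 * ∑ i, |β i - β' i| := by
  have := isFiniteMeasure_moment hT
  filter_upwards [ae_abs_sub_pow_le (q := q) hX] with w hw
  have h := moment_real_univ_le hT
  have h1 := abs_profile_sub_le (ν := moment μ) (ae_withDensity_le hT)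
    (weightedDist_nonneg (q := q) (x := w.1.1) (x' := w.2.1) hβ)
    (weightedDist_nonneg (q := q) (x := w.1.1) (x' := w.2.1) hβ')
  rw [kernelSlope, kernelSlope, ← sub_mul, abs_mul,
    abs_of_nonneg (by positivity : 0 ≤ |w.1.1 j - w.2.1 j| ^ q)]
  calc |pullback q (moment μ) β w - pullback q (moment μ) β' w| * |w.1.1 j - w.2.1 j| ^ q
      ≤ (T * (T * μ.real Set.univ) * ((1 + 2 * |MX|) ^ 2 * ∑ i, |β i - β' i|))
          * (1 + 2 * |MX|) ^ 2 := by
        gcongr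
        · refine h1.trans ?_
          gcongr
          exact abs_weightedDist_sub_le hw
        · exact hw j
    _ = _ := by ring

theorem ae_abs_pullback_update_le (hT : ∀ᵐ t : ℝ≥0 ∂μ, (t : ℝ) ≤ T)
    (hX : ∀ᵐ z ∂Q, ‖z.1‖ ≤ MX) (hβ : ∀ i, 0 ≤ β i) (j : Fin p) {b : ℝ}
    (hb : ∀ i, 0 ≤ Function.update β j b i) :
    ∀ᵐ w ∂Q.prod Q, |pullback q μ β w - pullback q μ (Function.update β j b) w
        - (b - β j) * kernelSlope q μ β j w|
      ≤ T ^ 2 * μ.real Set.univ * ((1 + 2 * |MX|) ^ 2) ^ 2 * (b - β j) ^ 2 := by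
  filter_upwards [ae_abs_sub_pow_le (q := q) hX] with w hw
  have h := abs_profile_sub_sub_le hT
    (weightedDist_nonneg (q := q) (x := w.1.1) (x' := w.2.1) hb)
    (weightedDist_nonneg (q := q) (x := w.1.1) (x' := w.2.1) hβ)
  have hd := weightedDist_update (q := q) β w.1.1 w.2.1 j b
  have hj := hw j
  have hj0 : 0 ≤ |w.1.1 j - w.2.1 j| ^ q := by positivity
  simp only [kernelSlope, pullback]
  set A := weightedDist q (Function.update β j b) w.1.1 w.2.1
  set A' := weightedDist q β w.1.1 w.2.1
  set d := |w.1.1 j - w.2.1 j| ^ q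
  have e1 : A' - A = -((b - β j) * d) := by rw [hd]; ring
  have e2 : A - A' = (b - β j) * d := by rw [hd]; ring
  rw [e1, e2] at h
  rw [abs_sub_comm] at h
  calc _ = |-((b - β j) * d) * profile (moment μ) A' - (profile μ A - profile μ A')| := by
        congr 1
        ring
    _ ≤ _ := h
    _ = T ^ 2 * μ.real Set.univ * d ^ 2 * (b - β j) ^ 2 := by ring
    _ ≤ _ := by gcongr

variable [IsProbabilityMeasure Q] {f f' : Space μ q p}

theorem IsRidge.abs_objective_sub_le (h : IsRidge lam Q β f) (h' : IsRidge lam Q β' f')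
    (hT : ∀ᵐ t : ℝ≥0 ∂μ, (t : ℝ) ≤ T) (hT0 : 0 < T) (hlam : 0 < lam)
    (hX : ∀ᵐ z ∂Q, ‖z.1‖ ≤ MX) (hY : MemLp (fun z : (Fin p → ℝ) × ℝ => z.2) 2 Q)
    (hβ : ∀ i, 0 ≤ β i) (hβ' : ∀ i, 0 ≤ β' i) :
    |objective μ q lam Q β' - objective μ q lam Q β|
      ≤ 1 / (2 * lam) * (T * μ.real Set.univ * ((1 + 2 * |MX|) ^ 2 * ∑ i, |β i - β' i|)
        * (l2norm Q (fun z => z.2) * l2norm Q (fun z => z.2))) := by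
  have hk := isPosKernel_pullback (q := q) (Q := Q) hT hβ
  have hk' := isPosKernel_pullback (q := q) (Q := Q) hT hβ'
  have hr := h.isResidual hT hlam hβ hY
  have hr' := h'.isResidual hT hlam hβ' hY
  rw [h.objective_eq hT hlam hY, h'.objective_eq hT hlam hY, hr.value_sub hk hk' hr', abs_mul,
    abs_of_pos (by positivity)]
  have hb := abs_pairing_le (ae_abs_pullback_sub_le (q := q) hT hT0 hX hβ hβ') hr.memLp hr'.memLp
  have n1 := hr.l2norm_le hlam hY hk
  have n2 := hr'.l2norm_le hlam hY hk'
  gcongr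
  refine hb.trans ?_
  gcongr
  all_goals exact l2norm_nonneg

/-- The derivative of the objective in the direction of `β_j`, one-sided at the boundary. -/
theorem IsRidge.hasDerivWithinAt_objective (h : IsRidge lam Q β f)
    (hT : ∀ᵐ t : ℝ≥0 ∂μ, (t : ℝ) ≤ T) (hT0 : 0 < T) (hlam : 0 < lam)
    (hX : ∀ᵐ z ∂Q, ‖z.1‖ ≤ MX) (hY : MemLp (fun z : (Fin p → ℝ) × ℝ => z.2) 2 Q)
    (hβ : ∀ i, 0 ≤ β i) (j : Fin p) :
    HasDerivWithinAt (fun b => objective μ q lam Q (Function.update β j b))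
      (1 / (2 * lam)
        * pairing Q (kernelSlope q μ β j) (residual q β f) (residual q β f))
      (Set.Ici 0) (β j) := by
  set R := (1 + 2 * |MX|) ^ 2
  set N := l2norm Q (fun z : (Fin p → ℝ) × ℝ => z.2)
  have hN : 0 ≤ N := l2norm_nonneg
  refine hasDerivWithinAt_of_abs_le_sq (C := 1 / (2 * lam) *
    (T ^ 2 * μ.real Set.univ * R ^ 2 * (N * N)
      + T * μ.real Set.univ * R * (N * (lam⁻¹ * (T * μ.real Set.univ * R * N))))) fun b hb => ?_
  have hβ' : ∀ i, 0 ≤ Function.update β j b i := fun i => by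
    rcases eq_or_ne i j with rfl | hi
    · simpa using hb
    · simpa [hi] using hβ i
  obtain ⟨f', h'⟩ := exists_isRidge (q := q) hT (Function.update β j b) hlam hY
  have hk := isPosKernel_pullback (q := q) (Q := Q) hT hβ
  have hk' := isPosKernel_pullback (q := q) (Q := Q) hT hβ'
  have hr := h.isResidual hT hlam hβ hY
  have hr' := h'.isResidual hT hlam hβ' hY
  have hd := memLp_kernelSlope (q := q) hT hT0 hX hβ j
  have hsum : ∑ i, |β i - Function.update β j b i| = |b - β j| := by
    rw [Finset.sum_eq_single j]
    · simp [abs_sub_comm]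
    · intro i _ hi
      simp [hi]
    · simp
  have n1 : l2norm Q (residual q β f) ≤ N := hr.l2norm_le hlam hY hk
  have n2 : l2norm Q (residual q (Function.update β j b) f') ≤ N := hr'.l2norm_le hlam hY hk'
  have n3 := hr.l2norm_sub_le hlam hY hk hk' hr' (ae_abs_pullback_sub_le hT hT0 hX hβ hβ')
  rw [hsum] at n3
  rw [Function.update_eq_self, h.objective_eq hT hlam hY, h'.objective_eq hT hlam hY,
    hr.value_sub hk hk' hr']
  set r := residual q β f
  set r' := residual q (Function.update β j b) f'
  have hi := hr.memLp.integrable one_le_two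
  have hi' := hr'.memLp.integrable one_le_two
  have hdd : MemLp (fun z => r' z - r z) 2 Q := hr'.memLp.sub hr.memLp
  have b1 := abs_pairing_le (ae_abs_pullback_update_le (q := q) hT hX hβ j hβ') hr.memLp hr'.memLp
  have hkk : MemLp (fun w => pullback q μ β w - pullback q μ (Function.update β j b) w) ⊤
      (Q.prod Q) := hk.memLp.sub hk'.memLp
  rw [pairing_sub_kernel hkk (hd.const_mul _) hi hi',
    pairing_const_mul] at b1
  have b2 := abs_pairing_le (ae_abs_kernelSlope_le (q := q) hT hT0 hX hβ j) hr.memLp hdd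
  rw [pairing_sub_right hd hi hi' hi] at b2
  -- The identity for the difference of values involves the mixed pair (r, r'), whereas the
  -- derivative has (r, r). The first bracket is the Taylor remainder of the kernel; the second is b
  -- - β_j times the displacement of the residual. Both are of order (b - β_j)².
  have hsplit : 1 / (2 * lam) * pairing Q
        (fun w => pullback q μ β w - pullback q μ (Function.update β j b) w) r r'
      - (b - β j) * (1 / (2 * lam) * pairing Q (kernelSlope q μ β j) r r)
      = 1 / (2 * lam) * ((pairing Q
        (fun w => pullback q μ β w - pullback q μ (Function.update β j b) w) r r'
          - (b - β j) * pairing Q (kernelSlope q μ β j) r r')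
        + (b - β j) * (pairing Q (kernelSlope q μ β j) r r'
          - pairing Q (kernelSlope q μ β j) r r)) := by ring
  rw [hsplit, abs_mul, abs_of_pos (by positivity : 0 < 1 / (2 * lam)), mul_assoc]
  gcongr
  refine (abs_add_le _ _).trans ?_
  rw [add_mul]
  refine add_le_add (b1.trans ?_) ?_
  · calc _ ≤ T ^ 2 * μ.real Set.univ * R ^ 2 * (b - β j) ^ 2 * (N * N) := by
          gcongr
          exact l2norm_nonneg
      _ = _ := by ring
  · rw [abs_mul]
    calc _ ≤ |b - β j| * (T * μ.real Set.univ * R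
            * (N * (lam⁻¹ * (T * μ.real Set.univ * (R * |b - β j|) * N)))) := by
          gcongr
          refine b2.trans ?_
          gcongr
          exact l2norm_nonneg
      _ = T * μ.real Set.univ * R * (N * (lam⁻¹ * (T * μ.real Set.univ * R * N)))
            * |b - β j| ^ 2 := by ring
      _ = _ := by rw [sq_abs]

/-- Telescoping in three steps: the kernel is changed first, then the residual in the left slot,
then in the right slot. The last two contribute the terms carrying λ⁻¹. -/
theorem IsRidge.abs_pairing_kernelSlope_sub_le (h : IsRidge lam Q β f)
    (h' : IsRidge lam Q β' f') (hT : ∀ᵐ t : ℝ≥0 ∂μ, (t : ℝ) ≤ T) (hT0 : 0 < T) (hlam : 0 < lam)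
    (hX : ∀ᵐ z ∂Q, ‖z.1‖ ≤ MX) (hY : MemLp (fun z : (Fin p → ℝ) × ℝ => z.2) 2 Q)
    (hβ : ∀ i, 0 ≤ β i) (hβ' : ∀ i, 0 ≤ β' i) (j : Fin p) :
    |pairing Q (kernelSlope q μ β' j) (residual q β' f') (residual q β' f')
        - pairing Q (kernelSlope q μ β j) (residual q β f) (residual q β f)|
      ≤ (T ^ 2 * μ.real Set.univ * ((1 + 2 * |MX|) ^ 2) ^ 2
          + 2 * lam⁻¹ * (T * μ.real Set.univ * (1 + 2 * |MX|) ^ 2) ^ 2)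
        * l2norm Q (fun z => z.2) ^ 2 * ∑ i, |β i - β' i| := by
  set R := (1 + 2 * |MX|) ^ 2
  set N := l2norm Q (fun z : (Fin p → ℝ) × ℝ => z.2)
  have hN : 0 ≤ N := l2norm_nonneg
  have hk := isPosKernel_pullback (q := q) (Q := Q) hT hβ
  have hk' := isPosKernel_pullback (q := q) (Q := Q) hT hβ'
  have hr := h.isResidual hT hlam hβ hY
  have hr' := h'.isResidual hT hlam hβ' hY
  have hd := memLp_kernelSlope (q := q) hT hT0 hX hβ j
  have hd' := memLp_kernelSlope (q := q) hT hT0 hX hβ' j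
  have n1 : l2norm Q (residual q β f) ≤ N := hr.l2norm_le hlam hY hk
  have n2 : l2norm Q (residual q β' f') ≤ N := hr'.l2norm_le hlam hY hk'
  have n3 := hr.l2norm_sub_le hlam hY hk hk' hr' (ae_abs_pullback_sub_le hT hT0 hX hβ hβ')
  have hS : 0 ≤ ∑ i, |β i - β' i| := Finset.sum_nonneg fun _ _ => abs_nonneg _
  set s := ∑ i, |β i - β' i|
  set r := residual q β f
  set r' := residual q β' f'
  have hi := hr.memLp.integrable one_le_two
  have hi' := hr'.memLp.integrable one_le_two
  have hdd : MemLp (fun z => r' z - r z) 2 Q := hr'.memLp.sub hr.memLp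
  have b1 := abs_pairing_le (ae_abs_kernelSlope_sub_le (q := q) hT hT0 hX hβ hβ' j)
    hr'.memLp hr'.memLp
  rw [pairing_sub_kernel hd hd' hi' hi'] at b1
  have b2 := abs_pairing_le (ae_abs_kernelSlope_le (q := q) hT hT0 hX hβ j) hr.memLp hdd
  rw [pairing_sub_right hd hi hi' hi] at b2
  have b3 := abs_pairing_le (ae_abs_kernelSlope_le (q := q) hT hT0 hX hβ j) hdd hr'.memLp
  rw [pairing_sub_left hd hi' hi hi'] at b3
  have c1 : T ^ 2 * μ.real Set.univ * R ^ 2 * s * (l2norm Q r' * l2norm Q r')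
      ≤ T ^ 2 * μ.real Set.univ * R ^ 2 * s * (N * N) := by
    gcongr
    exact l2norm_nonneg
  have c2 : T * μ.real Set.univ * R * (l2norm Q r * l2norm Q fun z => r' z - r z)
      ≤ T * μ.real Set.univ * R * (N * (lam⁻¹ * (T * μ.real Set.univ * (R * s) * N))) := by
    gcongr
    exact l2norm_nonneg
  have c3 : T * μ.real Set.univ * R * ((l2norm Q fun z => r' z - r z) * l2norm Q r')
      ≤ T * μ.real Set.univ * R * ((lam⁻¹ * (T * μ.real Set.univ * (R * s) * N)) * N) := by
    gcongr
    exact l2norm_nonneg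
  have a1 := abs_le.1 (b1.trans c1)
  have a2 := abs_le.1 (b2.trans c2)
  have a3 := abs_le.1 (b3.trans c3)
  rw [abs_le]
  constructor <;> linarith [a1.1, a1.2, a2.1, a2.2, a3.1, a3.2]

end Derivative


/-! ### Splitting off the coordinates outside the signal set -/

section Independence

variable {p : ℕ} {Q : Measure ((Fin p → ℝ) × ℝ)} [IsProbabilityMeasure Q] {S : Finset (Fin p)}

/-- The regression function of `Y` is a function of `X_S`. -/
theorem Captures.exists_regression (h : Captures Q S)
    (hY : Integrable (fun z : (Fin p → ℝ) × ℝ => z.2) Q) :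
    ∃ ρ : (S → ℝ) → ℝ, Measurable ρ ∧ Integrable (fun z => ρ (S.restrict z.1)) Q ∧
      ∀ g : (Fin p → ℝ) → ℝ, Measurable g → (∃ c, ∀ x, |g x| ≤ c) →
        ∫ z, g z.1 * z.2 ∂Q = ∫ z, g z.1 * ρ (S.restrict z.1) ∂Q := by
  have hS : Measurable fun z : (Fin p → ℝ) × ℝ => S.restrict z.1 :=
    (Finset.measurable_restrict S).comp measurable_fst
  obtain ⟨ρ, hρ, hρe⟩ := (stronglyMeasurable_condExp (μ := Q)
    (f := fun z : (Fin p → ℝ) × ℝ => z.2) (m := MeasurableSpace.comap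
      (fun z : (Fin p → ℝ) × ℝ => S.restrict z.1) inferInstance)).exists_eq_measurable_comp
  have hρi : Integrable (fun z : (Fin p → ℝ) × ℝ => ρ (S.restrict z.1)) Q := by
    change Integrable (ρ ∘ fun z : (Fin p → ℝ) × ℝ => S.restrict z.1) Q
    rw [← hρe]
    exact integrable_condExp
  refine ⟨ρ, hρ.measurable, hρi, fun g hg ⟨c, hc⟩ => ?_⟩
  have hm : MeasurableSpace.comap (fun z : (Fin p → ℝ) × ℝ => z.1) inferInstance
      ≤ (inferInstance : MeasurableSpace ((Fin p → ℝ) × ℝ)) := measurable_fst.comap_le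
  have hgm : StronglyMeasurable[MeasurableSpace.comap (fun z : (Fin p → ℝ) × ℝ => z.1)
      inferInstance] (fun z : (Fin p → ℝ) × ℝ => g z.1) :=
    (hg.comp (comap_measurable _)).stronglyMeasurable
  have hgt : MemLp (fun z : (Fin p → ℝ) × ℝ => g z.1) ⊤ Q :=
    memLp_top_of_bound (hg.comp measurable_fst).aestronglyMeasurable c
      (Filter.Eventually.of_forall fun z => hc z.1)
  set gX : (Fin p → ℝ) × ℝ → ℝ := fun z => g z.1
  set Y : (Fin p → ℝ) × ℝ → ℝ := fun z => z.2
  have hgy : Integrable (gX * Y) Q :=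
    hY.mul_of_top_right hgt
  have e := condExp_mul_of_stronglyMeasurable_left hgm hgy hY
  change ∫ z, (gX * Y) z ∂Q = _
  rw [← integral_condExp hm, integral_congr_ae e]
  refine integral_congr_ae ?_
  filter_upwards [h.condExp_eq] with z hz
  rw [Pi.mul_apply, hz, hρe]
  rfl

/-- Factorization of a bilinear form whose kernel is a product of a function of `X_S` and a
function of `X_{Sᶜ}`. -/
theorem Captures.pairing_mul_of_restrict (h : Captures Q S) {k₁ : (S → ℝ) → (S → ℝ) → ℝ}
    {k₂ : ((Sᶜ : Finset (Fin p)) → ℝ) → ((Sᶜ : Finset (Fin p)) → ℝ) → ℝ} {τ : (S → ℝ) → ℝ}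
    (hk₁ : Measurable (Function.uncurry k₁)) (hk₂ : Measurable (Function.uncurry k₂))
    {c₁ c₂ : ℝ} (hc₁ : ∀ s s', |k₁ s s'| ≤ c₁) (hc₂ : ∀ s s', |k₂ s s'| ≤ c₂)
    (hτ : Measurable τ) (hτi : Integrable (fun z => τ (S.restrict z.1)) Q) :
    pairing Q (fun w => k₁ (S.restrict w.1.1) (S.restrict w.2.1)
        * k₂ (Sᶜ.restrict w.1.1) (Sᶜ.restrict w.2.1))
      (fun z => τ (S.restrict z.1)) (fun z => τ (S.restrict z.1))
      = pairing Q (fun w => k₁ (S.restrict w.1.1) (S.restrict w.2.1))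
          (fun z => τ (S.restrict z.1)) (fun z => τ (S.restrict z.1))
        * ∫ w, k₂ (Sᶜ.restrict w.1.1) (Sᶜ.restrict w.2.1) ∂Q.prod Q := by
  have hS : Measurable fun z : (Fin p → ℝ) × ℝ => S.restrict z.1 :=
    (Finset.measurable_restrict S).comp measurable_fst
  have hC : Measurable fun z : (Fin p → ℝ) × ℝ => Sᶜ.restrict z.1 :=
    (Finset.measurable_restrict _).comp measurable_fst
  have m₁ : MemLp (fun w : ((Fin p → ℝ) × ℝ) × ((Fin p → ℝ) × ℝ) =>
      k₁ (S.restrict w.1.1) (S.restrict w.2.1)) ⊤ (Q.prod Q) :=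
    memLp_top_of_bound (hk₁.comp ((hS.comp measurable_fst).prodMk
      (hS.comp measurable_snd))).aestronglyMeasurable c₁
      (Filter.Eventually.of_forall fun w => hc₁ _ _)
  have m₂ : MemLp (fun w : ((Fin p → ℝ) × ℝ) × ((Fin p → ℝ) × ℝ) =>
      k₂ (Sᶜ.restrict w.1.1) (Sᶜ.restrict w.2.1)) ⊤ (Q.prod Q) :=
    memLp_top_of_bound (hk₂.comp ((hC.comp measurable_fst).prodMk
      (hC.comp measurable_snd))).aestronglyMeasurable c₂
      (Filter.Eventually.of_forall fun w => hc₂ _ _)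
  have m₁₂ : MemLp (fun w : ((Fin p → ℝ) × ℝ) × ((Fin p → ℝ) × ℝ) =>
      k₁ (S.restrict w.1.1) (S.restrict w.2.1) * k₂ (Sᶜ.restrict w.1.1) (Sᶜ.restrict w.2.1)) ⊤
      (Q.prod Q) := m₂.mul (r := ⊤) m₁
  set U : (S → ℝ) → ℝ := fun s => ∫ z, k₁ (S.restrict z.1) s * τ (S.restrict z.1) ∂Q
  set V : ((Sᶜ : Finset (Fin p)) → ℝ) → ℝ := fun s => ∫ z, k₂ (Sᶜ.restrict z.1) s ∂Q
  have hU : Measurable U := by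
    refine StronglyMeasurable.measurable (StronglyMeasurable.integral_prod_left
      (f := fun (z : (Fin p → ℝ) × ℝ) (s : S → ℝ) =>
        k₁ (S.restrict z.1) s * τ (S.restrict z.1)) ?_)
    exact ((hk₁.comp ((hS.comp measurable_fst).prodMk measurable_snd)).mul
      (hτ.comp (hS.comp measurable_fst))).stronglyMeasurable
  have hV : Measurable V := by
    refine StronglyMeasurable.measurable (StronglyMeasurable.integral_prod_left
      (f := fun (z : (Fin p → ℝ) × ℝ) (s : (Sᶜ : Finset (Fin p)) → ℝ) =>
        k₂ (Sᶜ.restrict z.1) s) ?_)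
    exact (hk₂.comp ((hC.comp measurable_fst).prodMk measurable_snd)).stronglyMeasurable
  -- Independence enters twice: in the inner integral with the second point frozen (`e1`), then in
  -- the outer integral (`e2`).
  have e1 : ∀ s s', ∫ z, (k₁ (S.restrict z.1) s * k₂ (Sᶜ.restrict z.1) s')
      * τ (S.restrict z.1) ∂Q = U s * V s' := by
    intro s s'
    have := h.indep.integral_fun_comp_mul_comp (𝕜 := ℝ) (f := fun a => k₁ a s * τ a)
      (g := fun b => k₂ b s') hS.aemeasurable hC.aemeasurable
      ((hk₁.comp (measurable_id.prodMk measurable_const)).mul hτ).aestronglyMeasurable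
      (hk₂.comp (measurable_id.prodMk measurable_const)).aestronglyMeasurable
    rw [← this]
    congr 1
    funext z
    ring
  have e2 : ∫ w, U (S.restrict w.1) * V (Sᶜ.restrict w.1) * τ (S.restrict w.1) ∂Q
      = (∫ w, U (S.restrict w.1) * τ (S.restrict w.1) ∂Q) * ∫ w, V (Sᶜ.restrict w.1) ∂Q := by
    have := h.indep.integral_fun_comp_mul_comp (𝕜 := ℝ) (f := fun a => U a * τ a)
      (g := V) hS.aemeasurable hC.aemeasurable (hU.mul hτ).aestronglyMeasurable
      hV.aestronglyMeasurable
    rw [← this]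
    congr 1
    funext z
    ring
  rw [pairing_eq_integral_integral m₁ hτi hτi,
    integral_prod_symm _ (memLp_one_iff_integrable.1 (m₂.mono_exponent le_top)), ← e2,
    pairing_eq_integral_integral m₁₂ hτi hτi]
  simp only [e1]

/-- Replacing `Y` by its regression function in a bilinear form with a kernel in `X`. -/
theorem Captures.pairing_residual_eq (hY : Integrable (fun z : (Fin p → ℝ) × ℝ => z.2) Q)
    {ρ a : (S → ℝ) → ℝ} (hρi : Integrable (fun z => ρ (S.restrict z.1)) Q)
    (hai : Integrable (fun z => a (S.restrict z.1)) Q)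
    (hρ : ∀ g : (Fin p → ℝ) → ℝ, Measurable g → (∃ c, ∀ x, |g x| ≤ c) →
        ∫ z, g z.1 * z.2 ∂Q = ∫ z, g z.1 * ρ (S.restrict z.1) ∂Q)
    {k : (Fin p → ℝ) → (Fin p → ℝ) → ℝ} (hk : Measurable (Function.uncurry k)) {c : ℝ}
    (hc : ∀ x x', |k x x'| ≤ c) (hsymm : ∀ x x', k x x' = k x' x) :
    pairing Q (fun w => k w.1.1 w.2.1) (fun z => z.2 - a (S.restrict z.1))
        (fun z => z.2 - a (S.restrict z.1))
      = pairing Q (fun w => k w.1.1 w.2.1) (fun z => ρ (S.restrict z.1) - a (S.restrict z.1))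
        (fun z => ρ (S.restrict z.1) - a (S.restrict z.1)) := by
  have hm : MemLp (fun w : ((Fin p → ℝ) × ℝ) × ((Fin p → ℝ) × ℝ) => k w.1.1 w.2.1) ⊤
      (Q.prod Q) :=
    memLp_top_of_bound (hk.comp ((measurable_fst.comp measurable_fst).prodMk
      (measurable_fst.comp measurable_snd))).aestronglyMeasurable c
      (Filter.Eventually.of_forall fun w => hc _ _)
  -- With the second point frozen, the kernel is a bounded function of X, to which `hρ` applies.
  -- This treats the left slot; symmetry of the kernel brings the other slot there.
  have key : ∀ v, Integrable v Q →
      pairing Q (fun w => k w.1.1 w.2.1) (fun z => z.2 - a (S.restrict z.1)) v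
      = pairing Q (fun w => k w.1.1 w.2.1)
        (fun z => ρ (S.restrict z.1) - a (S.restrict z.1)) v := by
    intro v hv
    rw [pairing_sub_left hm hY hai hv, pairing_sub_left hm hρi hai hv,
      pairing_eq_integral_integral hm hY hv, pairing_eq_integral_integral hm hρi hv]
    congr 2
    funext w
    rw [hρ (fun x => k x w.1) (hk.comp (measurable_id.prodMk measurable_const))
      ⟨c, fun x => hc _ _⟩]
  have i1 : Integrable (fun z : (Fin p → ℝ) × ℝ => z.2 - a (S.restrict z.1)) Q := hY.sub hai
  have i2 : Integrable (fun z : (Fin p → ℝ) × ℝ => ρ (S.restrict z.1) - a (S.restrict z.1)) Q :=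
    hρi.sub hai
  rw [key _ i1, pairing_swap fun z w => hsymm z.1 w.1, key _ i2]

end Independence

/-! ### Functions of the signal coordinates when the weights vanish off S -/

section ExtendZero

variable {p q : ℕ} {S : Finset (Fin p)} {β : Fin p → ℝ}

/-- Extension by zero of a vector indexed by `S`. -/
def extendZero (S : Finset (Fin p)) (s : S → ℝ) : Fin p → ℝ :=
  fun i => if h : i ∈ S then s ⟨i, h⟩ else 0

theorem measurable_extendZero : Measurable (extendZero S) := by
  refine measurable_pi_lambda _ fun i => ?_
  unfold extendZero
  split_ifs
  · exact measurable_pi_apply _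
  · exact measurable_const

theorem weightedDist_extendZero (hβS : ∀ i, i ∉ S → β i = 0) (x x' : Fin p → ℝ) :
    weightedDist q β (extendZero S (S.restrict x)) (extendZero S (S.restrict x'))
      = weightedDist q β x x' := by
  refine Finset.sum_congr rfl fun i _ => ?_
  by_cases h : i ∈ S
  · simp [extendZero, h]
  · simp [hβS i h]

theorem scale_extendZero (hq0 : q ≠ 0) (hβS : ∀ i, i ∉ S → β i = 0) (x : Fin p → ℝ) :
    scale q β (extendZero S (S.restrict x)) = scale q β x := by
  funext i
  by_cases h : i ∈ S
  · simp [scale, extendZero, h]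
  · simp [scale, hβS i h, Real.zero_rpow, hq0]

theorem measurable_profile_extendZero {ν : Measure ℝ≥0} [SFinite ν] :
    Measurable fun w : (S → ℝ) × (S → ℝ) =>
      profile ν (weightedDist q β (extendZero S w.1) (extendZero S w.2)) := by
  have e1 : Measurable fun w : (S → ℝ) × (S → ℝ) => extendZero S w.1 :=
    measurable_extendZero.comp measurable_fst
  have e2 : Measurable fun w : (S → ℝ) × (S → ℝ) => extendZero S w.2 :=
    measurable_extendZero.comp measurable_snd
  have e3 : Measurable fun w : (S → ℝ) × (S → ℝ) =>
      weightedDist q β (extendZero S w.1) (extendZero S w.2) := by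
    unfold weightedDist
    fun_prop
  exact measurable_profile.comp e3

end ExtendZero

/-! ### The lower bound for weights supported on the signal set -/

section LowerBound

variable {p q : ℕ} [hq : Fact (q = 1 ∨ q = 2)] {Q : Measure ((Fin p → ℝ) × ℝ)}
  [IsProbabilityMeasure Q] {MX : ℝ} {S : Finset (Fin p)} {μ : Measure ℝ≥0} [IsFiniteMeasure μ]
  {β : Fin p → ℝ} {lam T : ℝ}

/-- The difference of the two kernels is the pulled back kernel of (t - m_μ) μ(dt). This is a
positive measure since μ lives on [m_μ, ∞), hence its kernel has a nonnegative form too. -/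
theorem lowerEnd_mul_pairing_le (hT : ∀ᵐ t : ℝ≥0 ∂μ, (t : ℝ) ≤ T) (hβ : ∀ i, 0 ≤ β i)
    {u : (Fin p → ℝ) × ℝ → ℝ} (hu : MemLp u 2 Q) :
    lowerEnd μ * pairing Q (pullback q μ β) u u ≤ pairing Q (pullback q (moment μ) β) u u := by
  have := isFiniteMeasure_moment hT
  have hui := hu.integrable one_le_two
  set ν := μ.withDensity fun t => ((t - lowerEnd μ : ℝ≥0) : ENNReal)
  have : IsFiniteMeasure ν := isFiniteMeasure_withDensity_of_le (T := T) (by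
    filter_upwards [hT] with t ht
    exact (NNReal.coe_le_coe.2 tsub_le_self).trans ht)
  have hpos := (isPosKernel_pullback (q := q) (Q := Q) (ν := ν) (ae_withDensity_le hT)
    hβ).nonneg _ hu
  have hν : pullback q ν β = fun w => pullback q (moment μ) β w
      - lowerEnd μ * pullback q μ β w := by
    funext w
    exact profile_withDensity_sub hT ae_lowerEnd_le (weightedDist_nonneg hβ)
  rw [hν, pairing_sub_kernel (memLp_pullback hβ _) ((memLp_pullback hβ _).const_mul _) hui hui,
    pairing_const_mul] at hpos
  linarith

/-- The slope kernel is a function of X_S times a function of X_j with j outside S. Once Y is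
replaced by its regression function, the form factors by independence; the replacement is then
undone in the remaining factor, so that `lowerEnd_mul_pairing_le` applies to the original residual.
-/
theorem Captures.le_pairing_kernelSlope (h : Captures Q S)
    (hT : ∀ᵐ t : ℝ≥0 ∂μ, (t : ℝ) ≤ T) (hX : ∀ᵐ z ∂Q, ‖z.1‖ ≤ MX)
    (hY : MemLp (fun z : (Fin p → ℝ) × ℝ => z.2) 2 Q)
    (hβ : ∀ i, 0 ≤ β i) (hβS : ∀ i, i ∉ S → β i = 0) {j : Fin p} (hj : j ∉ S)
    (f : Space μ q p) :
    lowerEnd μ * (∫ w, |w.1.1 j - w.2.1 j| ^ q ∂(Q.prod Q))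
        * pairing Q (pullback q μ β) (residual q β f) (residual q β f)
      ≤ pairing Q (kernelSlope q μ β j) (residual q β f) (residual q β f) := by
  have hq0 : q ≠ 0 := by rcases hq.out with h | h <;> simp [h]
  have := isFiniteMeasure_moment hT
  have hYi := hY.integrable one_le_two
  obtain ⟨ρ, hρ, hρi, hρe⟩ := h.exists_regression hYi
  set a : (S → ℝ) → ℝ := fun s => f (scale q β (extendZero S s))
  have ha : Measurable a := (continuous_coe hT f).measurable.comp
    ((measurable_scale).comp measurable_extendZero)
  have hae : ∀ x, a (S.restrict x) = f (scale q β x) := fun x => by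
    simp only [a, scale_extendZero hq0 hβS]
  have hai : Integrable (fun z : (Fin p → ℝ) × ℝ => a (S.restrict z.1)) Q := by
    simp only [hae]
    exact (memLp_comp_scale hT f 1).integrable le_rfl
  have hr : residual q β f = fun z => z.2 - a (S.restrict z.1) := by
    funext z
    rw [hae, residual]
  have hri := (memLp_residual (q := q) (β := β) hT hY f).integrable one_le_two
  set R := (1 + 2 * |MX|) ^ 2
  have hR : 0 ≤ R := by positivity
  obtain ⟨k₁, k₁_def⟩ : ∃ k : (S → ℝ) → (S → ℝ) → ℝ, k = fun s s' =>
    profile (moment μ) (weightedDist q β (extendZero S s) (extendZero S s')) := ⟨_, rfl⟩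
  have hk₁ : Measurable (Function.uncurry k₁) := by
    rw [k₁_def]
    exact measurable_profile_extendZero
  have hc₁ : ∀ s s', |k₁ s s'| ≤ (moment μ).real Set.univ := fun s s' => by
    simp only [k₁_def]
    rw [abs_of_nonneg profile_nonneg]
    exact profile_le (weightedDist_nonneg hβ)
  have hjc : j ∈ Sᶜ := Finset.mem_compl.2 hj
  -- The factorization asks for kernels bounded everywhere, so |s_j - s'_j|^q is truncated at R;
  -- almost surely this changes nothing.
  obtain ⟨k₂, k₂_def⟩ : ∃ k : ((Sᶜ : Finset (Fin p)) → ℝ) → ((Sᶜ : Finset (Fin p)) → ℝ) → ℝ,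
    k = fun s s' => min (|s ⟨j, hjc⟩ - s' ⟨j, hjc⟩| ^ q) R := ⟨_, rfl⟩
  have hk₂ : Measurable (Function.uncurry k₂) := by
    simp only [k₂_def, Function.uncurry_def]
    fun_prop
  have hc₂ : ∀ s s', |k₂ s s'| ≤ R := fun s s' => by
    simp only [k₂_def]
    rw [abs_of_nonneg (le_min (by positivity) hR)]
    exact min_le_right _ _
  have hk₁' : (fun w : ((Fin p → ℝ) × ℝ) × ((Fin p → ℝ) × ℝ) =>
      k₁ (S.restrict w.1.1) (S.restrict w.2.1)) = pullback q (moment μ) β := by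
    funext w
    simp only [k₁_def, weightedDist_extendZero hβS, pullback]
  have hk₂' : (fun w : ((Fin p → ℝ) × ℝ) × ((Fin p → ℝ) × ℝ) =>
      k₂ (Sᶜ.restrict w.1.1) (Sᶜ.restrict w.2.1)) =ᵐ[Q.prod Q]
      fun w => |w.1.1 j - w.2.1 j| ^ q := by
    filter_upwards [ae_abs_sub_pow_le (q := q) hX] with w hw
    simpa only [k₂_def, Finset.restrict] using min_eq_left (hw j)
  have hslope : kernelSlope q μ β j =ᵐ[Q.prod Q] fun w =>
      k₁ (S.restrict w.1.1) (S.restrict w.2.1) * k₂ (Sᶜ.restrict w.1.1) (Sᶜ.restrict w.2.1) := by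
    filter_upwards [hk₂'] with w hw
    rw [hw, kernelSlope, ← hk₁']
  have mS : Measurable fun w : (Fin p → ℝ) × (Fin p → ℝ) => (S.restrict w.1, S.restrict w.2) :=
    ((Finset.measurable_restrict S).comp measurable_fst).prodMk
      ((Finset.measurable_restrict S).comp measurable_snd)
  have mC : Measurable fun w : (Fin p → ℝ) × (Fin p → ℝ) => (Sᶜ.restrict w.1, Sᶜ.restrict w.2) :=
    ((Finset.measurable_restrict _).comp measurable_fst).prodMk
      ((Finset.measurable_restrict _).comp measurable_snd)
  have s₁ : ∀ s s', k₁ s s' = k₁ s' s := fun s s' => by simp only [k₁_def, weightedDist_comm]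
  have s₂ : ∀ s s', k₂ s s' = k₂ s' s := fun s s' => by simp only [k₂_def, abs_sub_comm]
  have r₁ := Captures.pairing_residual_eq hYi hρi hai hρe
    (k := fun x x' => k₁ (S.restrict x) (S.restrict x')) (hk₁.comp mS)
    (fun x x' => hc₁ _ _) (fun x x' => s₁ _ _)
  have r₂ := Captures.pairing_residual_eq hYi hρi hai hρe
    (k := fun x x' => k₁ (S.restrict x) (S.restrict x') * k₂ (Sᶜ.restrict x) (Sᶜ.restrict x'))
    ((hk₁.comp mS).mul (hk₂.comp mC)) (c := (moment μ).real Set.univ * R)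
    (fun x x' => by
      rw [abs_mul]
      exact mul_le_mul (hc₁ _ _) (hc₂ _ _) (abs_nonneg _) measureReal_nonneg)
    (fun x x' => by rw [s₁, s₂])
  have hfac := h.pairing_mul_of_restrict (τ := fun s => ρ s - a s) hk₁ hk₂ hc₁ hc₂ (hρ.sub ha)
    (hρi.sub hai)
  rw [← hr] at r₁ r₂
  rw [pairing_congr_kernel hslope, r₂, hfac, ← r₁, integral_congr_ae hk₂', hk₁']
  have hE : 0 ≤ ∫ w, |w.1.1 j - w.2.1 j| ^ q ∂(Q.prod Q) :=
    integral_nonneg fun w => by positivity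
  calc _ = (lowerEnd μ * pairing Q (pullback q μ β) (residual q β f) (residual q β f))
        * ∫ w, |w.1.1 j - w.2.1 j| ^ q ∂(Q.prod Q) := by ring
    _ ≤ _ := mul_le_mul_of_nonneg_right
      (lowerEnd_mul_pairing_le hT hβ (memLp_residual hT hY f)) hE

theorem integral_abs_sub_pow_pos (hX : ∀ᵐ z ∂Q, ‖z.1‖ ≤ MX) {j : Fin p}
    (hj : 0 < Var[fun z : (Fin p → ℝ) × ℝ => z.1 j; Q]) :
    0 < ∫ w, |w.1.1 j - w.2.1 j| ^ q ∂(Q.prod Q) := by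
  have hq0 : q ≠ 0 := by rcases hq.out with h | h <;> simp [h]
  have hnn : ∀ w : ((Fin p → ℝ) × ℝ) × ((Fin p → ℝ) × ℝ), 0 ≤ |w.1.1 j - w.2.1 j| ^ q :=
    fun w => by positivity
  refine (integral_nonneg hnn).lt_of_ne' fun h0 => ?_
  have hi : Integrable (fun w : ((Fin p → ℝ) × ℝ) × ((Fin p → ℝ) × ℝ) =>
      |w.1.1 j - w.2.1 j| ^ q) (Q.prod Q) := by
    refine Integrable.of_bound (C := (1 + 2 * |MX|) ^ 2)
      (Measurable.aestronglyMeasurable (by fun_prop)) ?_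
    filter_upwards [ae_abs_sub_pow_le (q := q) hX] with w hw
    rw [Real.norm_eq_abs, abs_of_nonneg (hnn w)]
    exact hw j
  rw [integral_eq_zero_iff_of_nonneg hnn hi] at h0
  -- If the integral vanished, one good slice would show that X_j is almost surely equal to a fixed
  -- number, contradicting the positive variance.
  obtain ⟨z₀, hz₀⟩ := (Measure.ae_ae_of_ae_prod h0).exists
  have hconst : (fun z : (Fin p → ℝ) × ℝ => z.1 j) =ᵐ[Q] fun _ => z₀.1 j := by
    filter_upwards [hz₀] with z hz
    have : |z₀.1 j - z.1 j| ^ q = 0 := hz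
    rw [pow_eq_zero_iff hq0, abs_eq_zero] at this
    linarith
  rw [variance_congr hconst] at hj
  simp [variance_eq_integral] at hj

end LowerBound


/-! ### Data bounds and the final estimate -/

section Main

variable {p q : ℕ} [hq : Fact (q = 1 ∨ q = 2)] {Q : Measure ((Fin p → ℝ) × ℝ)}
  [IsProbabilityMeasure Q] {MX MY : ℝ}

theorem integral_abs_sub_pow_le (hX : ∀ᵐ z ∂Q, ‖z.1‖ ≤ MX) (j : Fin p) :
    ∫ w, |w.1.1 j - w.2.1 j| ^ q ∂(Q.prod Q) ≤ (1 + 2 * |MX|) ^ 2 := by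
  have h := norm_integral_le_of_norm_le_const (μ := Q.prod Q)
    (f := fun w : ((Fin p → ℝ) × ℝ) × ((Fin p → ℝ) × ℝ) => |w.1.1 j - w.2.1 j| ^ q)
    (C := (1 + 2 * |MX|) ^ 2) (by
      filter_upwards [ae_abs_sub_pow_le (q := q) hX] with w hw
      rw [Real.norm_eq_abs, abs_of_nonneg (by positivity)]
      exact hw j)
  rw [probReal_univ, mul_one] at h
  exact (le_abs_self _).trans h

theorem DataAssumption.memLp_snd (h : DataAssumption Q MX MY) :
    MemLp (fun z : (Fin p → ℝ) × ℝ => z.2) 2 Q :=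
  MemLp.of_bound measurable_snd.aestronglyMeasurable MY (h.bounded.mono fun _ hz => hz.2)

theorem DataAssumption.integral_sq_le (h : DataAssumption Q MX MY) :
    ∫ z, z.2 ^ 2 ∂Q ≤ MY ^ 2 := by
  refine (integral_mono_ae h.memLp_snd.integrable_sq (integrable_const (MY ^ 2)) ?_).trans_eq
    (by simp)
  filter_upwards [h.bounded] with z hz
  rw [← sq_abs]
  have := hz.2
  gcongr

theorem IsRidge.objective_mem_Icc {μ : Measure ℝ≥0} [IsFiniteMeasure μ] {β : Fin p → ℝ}
    {lam T : ℝ} {f : Space μ q p} (h : IsRidge lam Q β f) (hT : ∀ᵐ t : ℝ≥0 ∂μ, (t : ℝ) ≤ T)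
    (hlam : 0 < lam) (hβ : ∀ i, 0 ≤ β i) (hY : MemLp (fun z : (Fin p → ℝ) × ℝ => z.2) 2 Q) :
    objective μ q lam Q β ∈ Set.Icc 0 (1 / 2 * ∫ z, z.2 ^ 2 ∂Q) := by
  have hk := isPosKernel_pullback (q := q) (Q := Q) hT hβ
  have hr := h.isResidual hT hlam hβ hY
  rw [h.objective_eq hT hlam hY]
  refine ⟨mul_nonneg (by norm_num) (hr.integral_mul_nonneg hlam hk), ?_⟩
  refine mul_le_mul_of_nonneg_left ((integral_mul_le_l2norm hr.memLp hY).trans ?_) (by norm_num)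
  rw [← l2norm_sq, sq]
  exact mul_le_mul_of_nonneg_right (hr.l2norm_le hlam hY hk) l2norm_nonneg

/-- The real arithmetic behind the lower bound on the derivative. -/
theorem gradient_bound_of_estimates {m μ₀ M R T E lam s A F F₀ P P₀ K : ℝ} (hm : 0 ≤ m)
    (hμ₀ : 0 < μ₀) (hM : 0 < M) (hT : 0 < T) (hE : 0 ≤ E) (hER : E ≤ R)
    (hlam : 0 < lam) (hs : 0 ≤ s) (hK : 0 ≤ K) (hA : A ≤ M ^ 2)
    (hP : |P₀ - P| ≤ (T ^ 2 * μ₀ * R ^ 2 + 2 * lam⁻¹ * (T * μ₀ * R) ^ 2) * A * s)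
    (hKP : m * E * K ≤ P₀)
    (hgap : 4 * lam ^ 2 * (1 / 2 * A - F₀) ^ 2 ≤ A * (μ₀ * K))
    (hF : |F₀ - F| ≤ 1 / (2 * lam) * (T * μ₀ * (R * s) * A))
    (hF0 : F ∈ Set.Icc 0 (1 / 2 * A)) (hF₀ : F₀ ∈ Set.Icc 0 (1 / 2 * A)) :
    m * E / (μ₀ * M ^ 2) * lam * (max (1 / 2 * A - F) 0) ^ 2
      - (T ^ 2 * μ₀ * R ^ 2 * M ^ 2 + (T * μ₀ * R) ^ 2 * M ^ 2 + m * R ^ 2 * T * M ^ 2 + 1)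
        * ((1 + lam ^ 2) / lam ^ 2) * s
      ≤ 1 / (2 * lam) * P := by
  have hR : 0 ≤ R := hE.trans hER
  set c := m * E / (μ₀ * M ^ 2) with hc
  have hc0 : 0 ≤ c := by positivity
  set κ := (1 + lam ^ 2) / lam ^ 2 with hκ
  have hl : 0 < lam⁻¹ := by positivity
  have hκ' : κ = 1 + lam⁻¹ ^ 2 := by
    rw [hκ]
    field_simp
    ring
  have hκ1 : 1 ≤ κ := by rw [hκ']; nlinarith
  have hκ2 : lam⁻¹ ^ 2 ≤ κ := by rw [hκ']; linarith
  have hκ3 : lam⁻¹ / 2 ≤ κ := by rw [hκ']; nlinarith [sq_nonneg (lam⁻¹ - 1)]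
  have h2l : 1 / (2 * lam) = lam⁻¹ / 2 := by
    field_simp
  have a1 : (max (1 / 2 * A - F) 0) ^ 2 ≤ 2 * (1 / 2 * A - F₀) ^ 2 + 2 * (F₀ - F) ^ 2 := by
    have : (max (1 / 2 * A - F) 0) ^ 2 ≤ (1 / 2 * A - F) ^ 2 := by
      rw [max_eq_left (by linarith [hF0.2])]
    nlinarith [sq_nonneg ((1 / 2 * A - F₀) - (F₀ - F))]
  -- The estimates at β₀ give the main term with an extra factor 2, which is what `a1` consumes.
  have a2 : c * lam * (2 * (1 / 2 * A - F₀) ^ 2) ≤ lam⁻¹ / 2 * P₀ := by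
    have e1 : 4 * lam ^ 2 * (1 / 2 * A - F₀) ^ 2 ≤ M ^ 2 * (μ₀ * K) :=
      hgap.trans (by gcongr)
    calc c * lam * (2 * (1 / 2 * A - F₀) ^ 2)
        = c * (lam⁻¹ / 2) * (4 * lam ^ 2 * (1 / 2 * A - F₀) ^ 2) := by
          field_simp
          ring
      _ ≤ c * (lam⁻¹ / 2) * (M ^ 2 * (μ₀ * K)) := by gcongr
      _ = lam⁻¹ / 2 * (m * E * K) := by
          rw [hc]
          field_simp
      _ ≤ lam⁻¹ / 2 * P₀ := by gcongr
  -- One factor |F₀ - F| is bounded by the range M²/2 and only the other by the Lipschitz estimate.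
  -- The result is thus linear in s, and λ cancels.
  have a3 : c * lam * (2 * (F₀ - F) ^ 2) ≤ m * R ^ 2 * T * M ^ 2 * s := by
    have e1 : |F₀ - F| ≤ M ^ 2 / 2 := by
      rw [abs_le]
      constructor <;> linarith [hF0.1, hF0.2, hF₀.1, hF₀.2]
    have e2 : |F₀ - F| ≤ 1 / (2 * lam) * (T * μ₀ * (R * s) * M ^ 2) := hF.trans (by gcongr)
    have e3 : (F₀ - F) ^ 2 ≤ M ^ 2 / 2 * (1 / (2 * lam) * (T * μ₀ * (R * s) * M ^ 2)) := by
      rw [← sq_abs, sq]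
      exact mul_le_mul e1 e2 (abs_nonneg _) (by positivity)
    calc c * lam * (2 * (F₀ - F) ^ 2)
        ≤ c * lam * (2 * (M ^ 2 / 2 * (1 / (2 * lam) * (T * μ₀ * (R * s) * M ^ 2)))) := by gcongr
      _ = m * E * T * R * M ^ 2 * s / 2 := by
          rw [hc]
          field_simp
      _ ≤ m * R * T * R * M ^ 2 * s / 2 := by gcongr
      _ ≤ m * R ^ 2 * T * M ^ 2 * s := by
          have : 0 ≤ m * R ^ 2 * T * M ^ 2 * s := by positivity
          nlinarith
  have a4 : lam⁻¹ / 2 * (P₀ - P) ≤ (T ^ 2 * μ₀ * R ^ 2 * M ^ 2 + (T * μ₀ * R) ^ 2 * M ^ 2) * κ * s := by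
    have e1 : P₀ - P ≤ (T ^ 2 * μ₀ * R ^ 2 + 2 * lam⁻¹ * (T * μ₀ * R) ^ 2) * M ^ 2 * s :=
      (le_abs_self _).trans (hP.trans (by gcongr))
    calc lam⁻¹ / 2 * (P₀ - P)
        ≤ lam⁻¹ / 2 * ((T ^ 2 * μ₀ * R ^ 2 + 2 * lam⁻¹ * (T * μ₀ * R) ^ 2) * M ^ 2 * s) := by
          gcongr
      _ = T ^ 2 * μ₀ * R ^ 2 * M ^ 2 * s * (lam⁻¹ / 2)
          + (T * μ₀ * R) ^ 2 * M ^ 2 * s * lam⁻¹ ^ 2 := by ring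
      _ ≤ T ^ 2 * μ₀ * R ^ 2 * M ^ 2 * s * κ + (T * μ₀ * R) ^ 2 * M ^ 2 * s * κ := by gcongr
      _ = _ := by ring
  have a5 : m * R ^ 2 * T * M ^ 2 * s ≤ m * R ^ 2 * T * M ^ 2 * s * κ :=
    le_mul_of_one_le_right (by positivity) hκ1
  have a6 : 0 ≤ κ * s := by positivity
  have a7 : c * lam * (max (1 / 2 * A - F) 0) ^ 2
      ≤ c * lam * (2 * (1 / 2 * A - F₀) ^ 2 + 2 * (F₀ - F) ^ 2) := by gcongr
  rw [h2l]
  linarith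

end Main

end KRR

theorem mainTheorem4 (μ : Measure ℝ≥0) [IsFiniteMeasure μ] (hμ : KRR.KernelAssumption μ)
    (MX MY : ℝ) (hMY : 0 < MY) :
    ∃ C : ℝ, 0 < C ∧
      ∀ (q : ℕ) [Fact (q = 1 ∨ q = 2)] (p : ℕ) (Q : Measure ((Fin p → ℝ) × ℝ))
        [IsProbabilityMeasure Q], KRR.DataAssumption Q MX MY →
      ∀ S : Finset (Fin p), KRR.IsSignalSet Q S →
      ∀ lam : ℝ, 0 < lam →
      ∀ β : Fin p → ℝ, (∀ i, 0 ≤ β i) →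
      ∀ j : Fin p, j ∉ S →
        0 < KRR.gradConst μ q Q MY j ∧
        DifferentiableWithinAt ℝ
          (fun b => KRR.objective μ q lam Q (Function.update β j b)) (Set.Ici 0) (β j) ∧
        KRR.gradConst μ q Q MY j * lam
            * (max (KRR.objective μ q lam Q 0 - KRR.objective μ q lam Q β) 0) ^ 2
          - C * ((1 + lam ^ 2) / lam ^ 2) * ∑ i ∈ Sᶜ, |β i|
        ≤ derivWithin
          (fun b => KRR.objective μ q lam Q (Function.update β j b)) (Set.Ici 0) (β j) := by
  open KRR in
  obtain ⟨T, hT0, hT⟩ := hμ.exists_ae_le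
  have hμ₀ := hμ.real_univ_pos
  have hm : 0 < (lowerEnd μ : ℝ) := hμ.lowerEnd_pos
  -- The first two summands pay for moving the slope form from β₀ to β, the third for moving the
  -- gap; the final 1 is slack.
  refine ⟨T ^ 2 * μ.real Set.univ * ((1 + 2 * |MX|) ^ 2) ^ 2 * MY ^ 2
    + (T * μ.real Set.univ * (1 + 2 * |MX|) ^ 2) ^ 2 * MY ^ 2
    + lowerEnd μ * ((1 + 2 * |MX|) ^ 2) ^ 2 * T * MY ^ 2 + 1, by positivity, ?_⟩
  intro q hq p Q _ hD S hS lam hlam β hβ j hj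
  have hX : ∀ᵐ z ∂Q, ‖z.1‖ ≤ MX := hD.bounded.mono fun _ hz => hz.1
  have hY := hD.memLp_snd
  have hE : 0 < ∫ w, |w.1.1 j - w.2.1 j| ^ q ∂(Q.prod Q) :=
    integral_abs_sub_pow_pos hX (hD.variance_pos j)
  have hc : gradConst μ q Q MY j = lowerEnd μ * (∫ w, |w.1.1 j - w.2.1 j| ^ q ∂(Q.prod Q))
      / (μ.real Set.univ * MY ^ 2) := by
    rw [gradConst, profile_zero, abs_of_pos hμ₀]
  obtain ⟨f, hf⟩ := exists_isRidge (q := q) hT β hlam hY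
  have hderiv := hf.hasDerivWithinAt_objective hT hT0 hlam hX hY hβ j
  refine ⟨by rw [hc]; positivity, hderiv.differentiableWithinAt, ?_⟩
  rw [hderiv.derivWithin (uniqueDiffOn_Ici 0 _ (hβ j))]
  -- The comparison point: its ℓ¹ distance to β is exactly ‖β_{Sᶜ}‖₁.
  set β₀ : Fin p → ℝ := fun i => if i ∈ S then β i else 0
  have hβ₀ : ∀ i, 0 ≤ β₀ i := fun i => by
    simp only [β₀]
    split_ifs
    · exact hβ i
    · exact le_rfl
  have hβS : ∀ i, i ∉ S → β₀ i = 0 := fun i hi => by simp [β₀, hi]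
  have hsum : ∑ i, |β i - β₀ i| = ∑ i ∈ Sᶜ, |β i| := by
    rw [← Finset.sum_add_sum_compl S, Finset.sum_eq_zero, zero_add]
    · refine Finset.sum_congr rfl fun i hi => ?_
      rw [hβS i (Finset.mem_compl.1 hi), sub_zero]
    · intro i hi
      simp [β₀, hi]
  obtain ⟨f₀, hf₀⟩ := exists_isRidge (q := q) hT β₀ hlam hY
  have hK := (isPosKernel_pullback (q := q) (Q := Q) hT hβ₀).nonneg _
    (memLp_residual (q := q) (β := β₀) hT hY f₀)
  have hP := hf.abs_pairing_kernelSlope_sub_le hf₀ hT hT0 hlam hX hY hβ hβ₀ j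
  have hF := hf.abs_objective_sub_le hf₀ hT hT0 hlam hX hY hβ hβ₀
  rw [hsum, l2norm_sq] at hP
  rw [hsum, ← sq, l2norm_sq] at hF
  rw [hc, objective_zero hT hlam hY hD.centered]
  exact gradient_bound_of_estimates hm.le hμ₀ hMY hT0 hE.le (integral_abs_sub_pow_le hX j) hlam
    (Finset.sum_nonneg fun _ _ => abs_nonneg _) hK hD.integral_sq_le hP
    (hS.prop.le_pairing_kernelSlope hT hX hY hβ₀ hβS hj f₀) (hf₀.sq_gap_le hT hlam hβ₀ hY) hF
    (hf.objective_mem_Icc hT hlam hβ hY) (hf₀.objective_mem_Icc hT hlam hβ₀ hY)
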